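/- Let $1<p<\infty$, let $\mathbb T$ and $\mathbb D$ be the unit circle and the open unit disk, let $H^p_m\subset L^p_m$ be the spaces of $m$-component vector functions on $\mathbb T$ with entries in $H^p\subset L^p$, let $\mathbb P$ be the Riesz projection of $L^p_m$ onto $H^p_m$ (annihilating the functions whose Fourier coefficients of index $\ge 0$ vanish), and let $\mathrm{Rat}_0^m(\mathbb T)$ be the space of $m$-component vectors of strictly proper rational functions with poles only on $\mathbb T$. For an $m\times m$ rational matrix function $\Omega$ with $\det\Omega\not\equiv0$, possibly with poles on $\mathbb T$, let $T_\Omega$ be the (unbounded) operator in $H^p_m$ with domain $$\{f\in H^p_m:\ \Omega f=h+\eta \text{ for some } h\in L^p_m,\ \eta\in \mathrm{Rat}_0^m(\mathbb T)\},\qquad T_\Omega f=\mathbb P h .$$ Suppose that $\Omega$ has a Wiener-Hopf type factorization $$\Omega(z)=z^{-k}\,\Omega_-(z)\,\Omega_0(z)\,P_0(z)\,\Omega_+(z),\qquad k\ge 0,$$ where $\Omega_-,\Omega_-^{-1}$ have no poles outside $\mathbb D$ (infinity included), $\Omega_+,\Omega_+^{-1}$ have no poles in $\overline{\mathbb D}$,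 $\Omega_0$ is a diagonal matrix of rational functions with zeroes and poles only on $\mathbb T$, and $P_0$ is a lower triangular matrix polynomial with $\det P_0(z)=z^N$ for some integer $N\ge0$. Suppose that the middle factor $\Xi(z)=z^{-k}\Omega_0(z)P_0(z)$ has the form $$\Xi(z)=z^{-k}\left(\frac{p_{ij}(z)}{q_i(z)}\right)_{i,j=1}^m,\qquad p_{ij},q_i \text{ polynomials},\quad p_{ij}=0\ (i<j),\quad p_{jj}(z)=z^{k_j},$$ where each $q_i\neq0$ has zeroes only on $\mathbb T$, and that the factorization is in special form, that is, $$k_n-\deg q_n\ \ge\ \deg p_{jn}-\deg q_j,\qquad 1\le n<j\le m \qquad(\deg 0=-\infty).$$ Assume that $T_\Omega$ is Fredholm, and put $\kappa_j=k_j-\deg q_j-k$, $j=1,\dots,m$. Then for every integer $n$ the range of $T_{z^{n}\Omega}$ has finite codimension, and for every integer $\kappa$ $$\#\{j:\kappa_j=\kappa\}=\operatorname{codim}\operatorname{Ran}T_{z^{1-\kappa}\Omega}-2\operatorname{codim}\operatorname{Ran}T_{z^{-\kappa}\Omega}+\operatorname{codim}\operatorname{Ran}T_{z^{-\kappa-1}\Omega}.$$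 Moreover, the factorization indices are determined by $T_\Omega$ alone: if $\Omega'$ is an $m\times m$ rational matrix function with a factorization of the same kind in special form, with indices $\kappa_1',\dots,\kappa_m'$, and $T_{\Omega'}=T_\Omega$, then $(\kappa'_j)$ is a permutation of $(\kappa_j)$. -/

import Mathlib

open scoped ENNReal

noncomputable section

namespace RatToeplitz

open MeasureTheory AddCircle Polynomial

/-! ### The spaces `L^p`, `H^p` and the Riesz projection

The unit circle is parametrised by `UnitAddCircle`, with `t` corresponding to the point
`toCircle t = exp (2 π i t)`, and carries its normalised Lebesgue measure. -/

/-- The space `L^p` of the unit circle. -/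
abbrev LpCircle (p : ℝ≥0∞) : Type :=
  Lp ℂ p (haarAddCircle : Measure UnitAddCircle)

theorem integrable_coe {p : ℝ≥0∞} [hp : Fact (1 ≤ p)] (f : LpCircle p) :
    Integrable (f : UnitAddCircle → ℂ) haarAddCircle :=
  (Lp.memLp f).integrable hp.out

theorem fourierCoeff_add_coe {p : ℝ≥0∞} [Fact (1 ≤ p)] (f g : LpCircle p) (n : ℤ) :
    fourierCoeff (f + g : LpCircle p) n = fourierCoeff f n + fourierCoeff g n := by
  rw [fourierCoeff_congr_ae (Lp.coeFn_add f g),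
    fourierCoeff.add (integrable_coe f) (integrable_coe g), Pi.add_apply]

theorem fourierCoeff_smul_coe {p : ℝ≥0∞} [Fact (1 ≤ p)] (c : ℂ) (f : LpCircle p) (n : ℤ) :
    fourierCoeff (c • f : LpCircle p) n = c • fourierCoeff f n := by
  rw [fourierCoeff_congr_ae (Lp.coeFn_smul c f), fourierCoeff.const_smul]

theorem fourierCoeff_zero_coe {p : ℝ≥0∞} [Fact (1 ≤ p)] (n : ℤ) :
    fourierCoeff (0 : LpCircle p) n = 0 := by
  have h := fourierCoeff_smul_coe (0 : ℂ) (0 : LpCircle p) n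
  simpa using h

/-- The closed subspace of the `f` in `L^p` whose Fourier coefficients with index in `S`
vanish. -/
def vanishing (p : ℝ≥0∞) [Fact (1 ≤ p)] (S : Set ℤ) : Submodule ℂ (LpCircle p) where
  carrier := {f | ∀ n ∈ S, fourierCoeff f n = 0}
  add_mem' := by
    intro f g hf hg n hn
    rw [fourierCoeff_add_coe, hf n hn, hg n hn, add_zero]
  zero_mem' := fun n _ => fourierCoeff_zero_coe n
  smul_mem' := by
    intro c f hf n hn
    rw [fourierCoeff_smul_coe, hf n hn, smul_zero]

/-- The Hardy space `H^p`, identified through boundary values with a subspace of `L^p`: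
all Fourier coefficients of negative index vanish. -/
def hardy (p : ℝ≥0∞) [Fact (1 ≤ p)] : Submodule ℂ (LpCircle p) :=
  vanishing p {n | n < 0}

/-- The complementary space `K^p`: all Fourier coefficients of index `n ≥ 0` vanish. -/
def hardyMinus (p : ℝ≥0∞) [Fact (1 ≤ p)] : Submodule ℂ (LpCircle p) :=
  vanishing p {n | 0 ≤ n}

/-- A function in `L^p` is determined by its Fourier coefficients. -/
theorem eq_zero_of_fourierCoeff_eq_zero {p : ℝ≥0∞} [Fact (1 ≤ p)] (f : LpCircle p)
    (hf : ∀ n, fourierCoeff f n = 0) : f = 0 := by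
  have hint := integrable_coe f
  have hmul : ∀ φ : C(UnitAddCircle, ℂ),
      Integrable (fun t => φ t * f t) (haarAddCircle : Measure UnitAddCircle) := by
    intro φ
    refine hint.bdd_mul (c := ‖φ‖) φ.continuous.aestronglyMeasurable
      (Filter.Eventually.of_forall fun t => φ.norm_coe_le_norm t)
  have hcont : ∀ φ : C(UnitAddCircle, ℂ),
      ∫ t, φ t * f t ∂(haarAddCircle : Measure UnitAddCircle) = 0 := by
    let L : C(UnitAddCircle, ℂ) →ₗ[ℂ] ℂ :=
      { toFun := fun φ => ∫ t, φ t * f t ∂(haarAddCircle : Measure UnitAddCircle)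
        map_add' := by
          intro φ ψ
          rw [← integral_add (hmul φ) (hmul ψ)]
          simp [add_mul]
        map_smul' := by
          intro c φ
          simp [mul_assoc, integral_const_mul] }
    have hLc : Continuous L := by
      refine AddMonoidHomClass.continuous_of_bound L
        (∫ t, ‖f t‖ ∂(haarAddCircle : Measure UnitAddCircle)) fun φ => ?_
      change ‖∫ t, φ t * f t ∂(haarAddCircle : Measure UnitAddCircle)‖ ≤ _
      refine (norm_integral_le_integral_norm _).trans ?_
      rw [mul_comm, ← integral_const_mul]
      refine integral_mono (hmul φ).norm (hint.norm.const_mul _) fun t => ?_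
      rw [norm_mul]
      exact mul_le_mul_of_nonneg_right (φ.norm_coe_le_norm t) (norm_nonneg _)
    have hker : (⊤ : Submodule ℂ C(UnitAddCircle, ℂ)) ≤ LinearMap.ker L := by
      rw [← span_fourier_closure_eq_top]
      refine Submodule.topologicalClosure_minimal _ (Submodule.span_le.2 ?_) ?_
      · rintro _ ⟨n, rfl⟩
        have h := hf (-n)
        rw [fourierCoeff, neg_neg] at h
        exact h
      · exact isClosed_singleton.preimage hLc
    intro φ
    exact hker (Submodule.mem_top : φ ∈ ⊤)
  have hae : (f : UnitAddCircle → ℂ) =ᵐ[haarAddCircle] 0 := by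
    refine ae_eq_zero_of_forall_setIntegral_isClosed_eq_zero hint fun A hA => ?_
    have hlim : Filter.Tendsto
        (fun n => ∫ t, (((hA.apprSeq n t : NNReal) : ℝ) : ℂ) * f t
          ∂(haarAddCircle : Measure UnitAddCircle)) Filter.atTop
        (nhds (∫ t, A.indicator (fun t => f t) t ∂(haarAddCircle : Measure UnitAddCircle))) := by
      refine tendsto_integral_of_dominated_convergence (fun t => ‖f t‖) ?_ hint.norm ?_ ?_
      · intro n
        refine Continuous.aestronglyMeasurable ?_ |>.mul hint.1
        exact Complex.continuous_ofReal.comp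
          (NNReal.continuous_coe.comp (hA.apprSeq n).continuous)
      · intro n
        refine Filter.Eventually.of_forall fun t => ?_
        rw [norm_mul]
        refine mul_le_of_le_one_left (norm_nonneg _) ?_
        have := HasOuterApproxClosed.apprSeq_apply_le_one hA n t
        simpa using this
      · refine Filter.Eventually.of_forall fun t => ?_
        have h1 := (tendsto_pi_nhds.1 (HasOuterApproxClosed.tendsto_apprSeq hA)) t
        have h2 := (((Complex.continuous_ofReal.comp NNReal.continuous_coe).tendsto _).comp
          h1).mul_const (f t)
        refine h2.congr' ?_ |>.trans ?_
        · exact Filter.Eventually.of_forall fun n => rfl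
        · by_cases ht : t ∈ A <;> simp [ht]
    have hz : ∀ n, ∫ t, (((hA.apprSeq n t : NNReal) : ℝ) : ℂ) * f t
        ∂(haarAddCircle : Measure UnitAddCircle) = 0 := fun n =>
      hcont ⟨fun t => (((hA.apprSeq n t : NNReal) : ℝ) : ℂ),
        Complex.continuous_ofReal.comp (NNReal.continuous_coe.comp (hA.apprSeq n).continuous)⟩
    simp only [hz] at hlim
    rw [← integral_indicator hA.measurableSet]
    exact (tendsto_nhds_unique tendsto_const_nhds hlim).symm
  exact (Lp.eq_zero_iff_ae_eq_zero).2 hae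

theorem disjoint_hardy (p : ℝ≥0∞) [Fact (1 ≤ p)] : Disjoint (hardyMinus p) (hardy p) := by
  rw [Submodule.disjoint_def]
  intro f hK hH
  refine eq_zero_of_fourierCoeff_eq_zero f fun n => ?_
  rcases lt_or_ge n 0 with hn | hn
  · exact hH n hn
  · exact hK n hn

theorem exists_rieszProjection (p : ℝ≥0∞) [Fact (1 ≤ p)] :
    ∃ P : LpCircle p →ₗ[ℂ] hardy p,
      (∀ g : hardy p, P g = g) ∧ ∀ u ∈ hardyMinus p, P u = 0 := by
  obtain ⟨C, hC, hcompl⟩ := (disjoint_hardy p).exists_isCompl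
  exact ⟨(hardy p).projectionOnto C hcompl.symm,
    fun g => Submodule.projectionOnto_apply_left _ g,
    fun u hu => Submodule.projectionOnto_apply_of_mem_right _ (hC hu)⟩

/-- The Riesz projection of `L^p` onto `H^p`, `1 < p < ∞`: the linear map that is the identity
on `H^p` and zero on `K^p`. By the theorem of M. Riesz, `L^p = H^p ⊕ K^p` for `1 < p < ∞`, so
for these `p` the two properties determine the map. -/
def rieszProjection (p : ℝ≥0∞) [Fact (1 ≤ p)] : LpCircle p →ₗ[ℂ] hardy p :=
  Classical.choose (exists_rieszProjection p)

theorem rieszProjection_coe {p : ℝ≥0∞} [Fact (1 ≤ p)] (g : hardy p) :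
    rieszProjection p g = g :=
  (Classical.choose_spec (exists_rieszProjection p)).1 g

theorem rieszProjection_eq_zero {p : ℝ≥0∞} [Fact (1 ≤ p)] {u : LpCircle p}
    (hu : u ∈ hardyMinus p) : rieszProjection p u = 0 :=
  (Classical.choose_spec (exists_rieszProjection p)).2 u hu

/-! ### Rational functions -/

/-- `z` is a pole of the rational function `r` (the denominator is the one of the reduced
fraction). -/
def IsPole (r : RatFunc ℂ) (z : ℂ) : Prop := r.denom.IsRoot z

/-- `r` is strictly proper: it vanishes at infinity. -/
def IsStrictlyProper (r : RatFunc ℂ) : Prop := r.num.degree < r.denom.degree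

/-- `r` has no pole at infinity. -/
def IsProper (r : RatFunc ℂ) : Prop := r.num.degree ≤ r.denom.degree

/-- The value of `r` at the point of the unit circle with parameter `t`, meaningful
unless that point is one of the finitely many poles of `r`. -/
def onCircle (r : RatFunc ℂ) (t : UnitAddCircle) : ℂ :=
  r.eval (RingHom.id ℂ) (toCircle t : ℂ)

/-- The space `Rat₀(𝕋)` of strictly proper rational functions with poles only on the unit
circle. -/
def ratZeroCircle : Submodule ℂ (RatFunc ℂ) where
  carrier := {r | (∀ z, IsPole r z → ‖z‖ = 1) ∧ IsStrictlyProper r}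
  zero_mem' := by
    refine ⟨fun z hz => ?_, ?_⟩
    · simp [IsPole] at hz
    · simp [IsStrictlyProper]
  add_mem' := by
    rintro r s ⟨hr, hr'⟩ ⟨hs, hs'⟩
    refine ⟨fun z hz => ?_, ?_⟩
    · have h : (r.denom * s.denom).IsRoot z := hz.dvd (RatFunc.denom_add_dvd r s)
      rcases Polynomial.root_mul.1 h with h | h
      · exact hr z h
      · exact hs z h
    · unfold IsStrictlyProper at *
      have h := congrArg Polynomial.degree (RatFunc.num_denom_add r s)
      rw [degree_mul, degree_mul, degree_mul] at h
      have hd : ∀ x : RatFunc ℂ, x.denom.degree ≠ ⊥ := fun x =>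
        fun h => RatFunc.denom_ne_zero x (degree_eq_bot.1 h)
      have h1 : (r.num * s.denom + r.denom * s.num).degree < r.denom.degree + s.denom.degree := by
        refine (degree_add_le _ _).trans_lt (max_lt ?_ ?_)
        · rw [degree_mul]
          exact WithBot.add_lt_add_right (hd s) hr'
        · rw [degree_mul]
          exact WithBot.add_lt_add_left (hd r) hs'
      by_contra hcon
      have h2 := add_le_add (not_lt.1 hcon) (le_refl (r.denom.degree + s.denom.degree))
      rw [h, add_comm (r + s).denom.degree] at h2
      exact absurd (WithBot.add_lt_add_right (hd (r + s)) h1) (not_lt.2 h2)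
  smul_mem' := by
    rintro c r ⟨hr, hr'⟩
    by_cases hc : c = 0
    · subst hc
      refine ⟨fun z hz => ?_, ?_⟩
      · simp [IsPole] at hz
      · simp [IsStrictlyProper]
    have hsm : c • r = RatFunc.C c * r := RatFunc.smul_eq_C_mul c r
    have hdd : (c • r).denom ∣ r.denom := by
      have := RatFunc.denom_mul_dvd (RatFunc.C c) r
      rwa [RatFunc.denom_C, one_mul, ← hsm] at this
    refine ⟨fun z hz => hr z (hz.dvd hdd), ?_⟩
    unfold IsStrictlyProper at *
    have h := congrArg Polynomial.degree (RatFunc.num_denom_mul (RatFunc.C c) r)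
    rw [RatFunc.denom_C, RatFunc.num_C, one_mul, ← hsm, degree_mul, degree_mul, degree_mul,
      degree_C hc, zero_add] at h
    have hd : ∀ x : RatFunc ℂ, x.denom.degree ≠ ⊥ := fun x =>
      fun h => RatFunc.denom_ne_zero x (degree_eq_bot.1 h)
    by_contra hcon
    have h2 := add_le_add (not_lt.1 hcon) (le_refl r.denom.degree)
    rw [h, add_comm (c • r).denom.degree] at h2
    exact absurd (WithBot.add_lt_add_right (hd (c • r)) hr') (not_lt.2 h2)

theorem infinite_unitAddCircle : Infinite UnitAddCircle := by
  have h : Infinite (Set.Ico (0 : ℝ) (0 + 1)) := (Set.Ico_infinite (by norm_num)).to_subtype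
  exact (AddCircle.equivIco (1 : ℝ) 0).infinite_iff.2 h

theorem measure_singleton_unitAddCircle (t : UnitAddCircle) :
    (haarAddCircle : Measure UnitAddCircle) {t} = 0 := by
  by_contra h
  have hall : ∀ s : UnitAddCircle, (haarAddCircle : Measure UnitAddCircle) {s}
      = (haarAddCircle : Measure UnitAddCircle) {t} := fun s => by
    rw [Measure.addHaar_singleton, Measure.addHaar_singleton _ t]
  have := infinite_unitAddCircle
  exact measure_ne_top (haarAddCircle : Measure UnitAddCircle) Set.univ
    (Set.infinite_univ.meas_eq_top ⟨_, h, fun s _ => (hall s).ge⟩)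

theorem ae_not_isPole (r : RatFunc ℂ) :
    ∀ᵐ t ∂(haarAddCircle : Measure UnitAddCircle), ¬ IsPole r (toCircle t : ℂ) := by
  have hfin : {t : UnitAddCircle | IsPole r (toCircle t : ℂ)}.Finite := by
    have h1 : {z : ℂ | IsPole r z}.Finite :=
      Polynomial.finite_setOfPred_isRoot (RatFunc.denom_ne_zero r)
    refine h1.preimage (f := fun t : UnitAddCircle => (toCircle t : ℂ)) ?_
    intro a _ b _ hab
    exact injective_toCircle one_ne_zero (Subtype.ext hab)
  rw [ae_iff]
  simp only [not_not]
  have h0 : (haarAddCircle : Measure UnitAddCircle)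
      (⋃ t ∈ {t : UnitAddCircle | IsPole r (toCircle t : ℂ)}, {t}) = 0 :=
    (measure_biUnion_null_iff hfin.countable).2 fun t _ => measure_singleton_unitAddCircle t
  rwa [Set.biUnion_of_singleton] at h0

theorem onCircle_add (r s : RatFunc ℂ) :
    ∀ᵐ t ∂(haarAddCircle : Measure UnitAddCircle),
      onCircle (r + s) t = onCircle r t + onCircle s t := by
  filter_upwards [ae_not_isPole r, ae_not_isPole s] with t hr hs
  exact RatFunc.eval_add (f := RingHom.id ℂ) (a := (toCircle t : ℂ)) hr hs

theorem onCircle_smul (c : ℂ) (r : RatFunc ℂ) :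
    ∀ᵐ t ∂(haarAddCircle : Measure UnitAddCircle),
      onCircle (c • r) t = c * onCircle r t := by
  filter_upwards [ae_not_isPole r] with t hr
  rw [onCircle, RatFunc.smul_eq_C_mul, RatFunc.eval_mul (f := RingHom.id ℂ) (a := (toCircle t : ℂ)) (by simp) hr,
    RatFunc.eval_C]
  rfl

/-! ### The Toeplitz-like operator -/

/-- The space `H^p_m` of vector functions with `m` components in `H^p`. -/
abbrev HardyVec (p : ℝ≥0∞) [Fact (1 ≤ p)] (m : ℕ) : Type := Fin m → hardy p

/-- `Ω f = h + η` almost everywhere on the unit circle. -/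
def IsDecomposition {p : ℝ≥0∞} [Fact (1 ≤ p)] {m : ℕ} (Ω : Matrix (Fin m) (Fin m) (RatFunc ℂ))
    (f : HardyVec p m) (h : Fin m → LpCircle p) (η : Fin m → RatFunc ℂ) : Prop :=
  ∀ i, ∀ᵐ t ∂(haarAddCircle : Measure UnitAddCircle),
    ∑ j, onCircle (Ω i j) t * (f j : LpCircle p) t = h i t + onCircle (η i) t

/-- The graph of `T_Ω`: the pairs `(f, ℙ h)` where `f ∈ H^p_m` satisfies `Ω f = h + η` with
`h ∈ L^p_m` and `η ∈ Rat₀^m(𝕋)`, the Riesz projection `ℙ` acting componentwise. -/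
def toeplitzGraph (p : ℝ≥0∞) [Fact (1 ≤ p)] {m : ℕ} (Ω : Matrix (Fin m) (Fin m) (RatFunc ℂ)) :
    Submodule ℂ (HardyVec p m × HardyVec p m) where
  carrier := {x | ∃ (h : Fin m → LpCircle p) (η : Fin m → RatFunc ℂ),
    (∀ i, η i ∈ ratZeroCircle) ∧ IsDecomposition Ω x.1 h η ∧
      x.2 = fun i => rieszProjection p (h i)}
  zero_mem' := by
    refine ⟨0, 0, fun i => ratZeroCircle.zero_mem, fun i => ?_, ?_⟩
    · have hz := Lp.coeFn_zero ℂ p (haarAddCircle : Measure UnitAddCircle)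
      filter_upwards [hz] with t ht
      simp [onCircle]
    · funext i
      simp
  add_mem' := by
    rintro ⟨f, g⟩ ⟨f', g'⟩ ⟨h, η, hη, hd, hg⟩ ⟨h', η', hη', hd', hg'⟩
    refine ⟨h + h', η + η', fun i => ratZeroCircle.add_mem (hη i) (hη' i), fun i => ?_, ?_⟩
    · have hsum : ∀ᵐ t ∂(haarAddCircle : Measure UnitAddCircle),
          ∀ j, ((f j + f' j : hardy p) : LpCircle p) t
            = (f j : LpCircle p) t + (f' j : LpCircle p) t :=
        ae_all_iff.2 fun j => Lp.coeFn_add (f j : LpCircle p) (f' j : LpCircle p)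
      filter_upwards [hd i, hd' i, hsum, Lp.coeFn_add (h i) (h' i), onCircle_add (η i) (η' i)]
        with t h1 h2 h3 h4 h5
      simp only [Prod.fst_add, Pi.add_apply, h3, mul_add, Finset.sum_add_distrib, h4, h5]
      rw [h1, h2]
      ring
    · simp only at hg hg'
      subst hg hg'
      funext i
      simp
  smul_mem' := by
    rintro c ⟨f, g⟩ ⟨h, η, hη, hd, hg⟩
    refine ⟨c • h, c • η, fun i => ratZeroCircle.smul_mem c (hη i), fun i => ?_, ?_⟩
    · have hsum : ∀ᵐ t ∂(haarAddCircle : Measure UnitAddCircle),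
          ∀ j, ((c • f j : hardy p) : LpCircle p) t = c * (f j : LpCircle p) t :=
        ae_all_iff.2 fun j => Lp.coeFn_smul c (f j : LpCircle p)
      filter_upwards [hd i, hsum, Lp.coeFn_smul c (h i), onCircle_smul c (η i)]
        with t h1 h3 h4 h5
      simp only [Prod.smul_fst, Pi.smul_apply, h3, h4, h5, smul_eq_mul]
      rw [← mul_add, ← h1, Finset.mul_sum]
      exact Finset.sum_congr rfl fun j _ => by ring
    · simp only at hg
      subst hg
      funext i
      simp

/-- The Toeplitz-like operator `T_Ω` in `H^p_m`, as an unbounded operator. Its domain consists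
of all `f ∈ H^p_m` with `Ω f = h + η`, `h ∈ L^p_m`, `η ∈ Rat₀^m(𝕋)`, and `T_Ω f = ℙ h`. (The
graph is single-valued, since `L^p` contains no nonzero function of `Rat₀(𝕋)`.) -/
def toeplitz (p : ℝ≥0∞) [Fact (1 ≤ p)] {m : ℕ} (Ω : Matrix (Fin m) (Fin m) (RatFunc ℂ)) :
    HardyVec p m →ₗ.[ℂ] HardyVec p m :=
  (toeplitzGraph p Ω).toLinearPMap

/-- An unbounded operator is Fredholm when it is closed, its kernel has finite dimension and its
range has finite codimension. -/
structure IsFredholm {E : Type*} [AddCommGroup E] [Module ℂ E] [TopologicalSpace E]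
    (T : E →ₗ.[ℂ] E) : Prop where
  isClosed : T.IsClosed
  finite_ker : FiniteDimensional ℂ (LinearMap.ker T.toFun)
  finite_coker : FiniteDimensional ℂ (E ⧸ LinearMap.range T.toFun)

/-- The codimension of the range (meaningful when the quotient by the range has finite
dimension). -/
def codimRange {E : Type*} [AddCommGroup E] [Module ℂ E] (T : E →ₗ.[ℂ] E) : ℕ :=
  Module.finrank ℂ (E ⧸ LinearMap.range T.toFun)

/-! ### Wiener-Hopf type factorizations -/

/-- A plus function: no poles in the closed unit disk. -/
def IsPlusFunction {m : ℕ} (A : Matrix (Fin m) (Fin m) (RatFunc ℂ)) : Prop :=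
  ∀ i j z, IsPole (A i j) z → 1 < ‖z‖

/-- A minus function: no poles outside the open unit disk, infinity included. -/
def IsMinusFunction {m : ℕ} (A : Matrix (Fin m) (Fin m) (RatFunc ℂ)) : Prop :=
  ∀ i j, (∀ z, IsPole (A i j) z → ‖z‖ < 1) ∧ IsProper (A i j)

/-- A Wiener-Hopf type factorization `Ω(z) = z^{-k} Ω₋(z) Ω₀(z) P₀(z) Ω₊(z)`, with
`Ω₀ = diag (φ_j)`. -/
structure WienerHopfFactorization {m : ℕ} (Ω : Matrix (Fin m) (Fin m) (RatFunc ℂ)) where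
  k : ℕ
  Ωminus : Matrix (Fin m) (Fin m) (RatFunc ℂ)
  φ : Fin m → RatFunc ℂ
  P₀ : Matrix (Fin m) (Fin m) ℂ[X]
  Ωplus : Matrix (Fin m) (Fin m) (RatFunc ℂ)
  isUnit_minus : IsUnit Ωminus
  minus : IsMinusFunction Ωminus
  minus_inv : IsMinusFunction Ωminus⁻¹
  isUnit_plus : IsUnit Ωplus
  plus : IsPlusFunction Ωplus
  plus_inv : IsPlusFunction Ωplus⁻¹
  φ_ne_zero : ∀ j, φ j ≠ 0
  φ_poles : ∀ j z, IsPole (φ j) z → ‖z‖ = 1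
  φ_zeros : ∀ j z, IsPole (φ j)⁻¹ z → ‖z‖ = 1
  P₀_lower : ∀ i j, i < j → P₀ i j = 0
  P₀_det : ∃ N : ℕ, P₀.det = X ^ N
  eq : Ω = (RatFunc.X : RatFunc ℂ) ^ (-(k : ℤ)) •
    (Ωminus * Matrix.diagonal φ * P₀.map (algebraMap ℂ[X] (RatFunc ℂ)) * Ωplus)

/-- The middle factor `Ξ(z) = z^{-k} Ω₀(z) P₀(z)`. -/
def WienerHopfFactorization.middle {m : ℕ} {Ω : Matrix (Fin m) (Fin m) (RatFunc ℂ)}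
    (F : WienerHopfFactorization Ω) : Matrix (Fin m) (Fin m) (RatFunc ℂ) :=
  (RatFunc.X : RatFunc ℂ) ^ (-(F.k : ℤ)) •
    (Matrix.diagonal F.φ * F.P₀.map (algebraMap ℂ[X] (RatFunc ℂ)))

/-- The representation `Ξ = z^{-k} (p_{ij} / q_i)` of the middle factor: the `p_{ij}` and `q_i`
are polynomials, `(p_{ij})` is lower triangular with diagonal entries `p_{jj} = z^{k_j}`, and
`q_i` has zeroes only on the unit circle. The integer `k_j` is called `e j` here. -/
structure MiddleForm {m : ℕ} {Ω : Matrix (Fin m) (Fin m) (RatFunc ℂ)}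
    (F : WienerHopfFactorization Ω) where
  p : Matrix (Fin m) (Fin m) ℂ[X]
  q : Fin m → ℂ[X]
  e : Fin m → ℕ
  p_lower : ∀ i j, i < j → p i j = 0
  p_diag : ∀ j, p j j = X ^ e j
  q_ne_zero : ∀ i, q i ≠ 0
  q_roots : ∀ i z, (q i).IsRoot z → ‖z‖ = 1
  eq : ∀ i j, F.middle i j = (RatFunc.X : RatFunc ℂ) ^ (-(F.k : ℤ)) *
    (algebraMap ℂ[X] (RatFunc ℂ) (p i j) / algebraMap ℂ[X] (RatFunc ℂ) (q i))

/-- Special form: in each column `n` of `Ξ`, the difference between the degrees of numerator and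
denominator is largest on the diagonal, `k_n - deg q_n ≥ deg p_{jn} - deg q_j` for `j > n`, where
the zero polynomial has degree `-∞`. -/
def MiddleForm.IsSpecial {m : ℕ} {Ω : Matrix (Fin m) (Fin m) (RatFunc ℂ)}
    {F : WienerHopfFactorization Ω} (M : MiddleForm F) : Prop :=
  ∀ n j, n < j → M.p j n ≠ 0 →
    ((M.p j n).natDegree : ℤ) - (M.q j).natDegree ≤ (M.e n : ℤ) - (M.q n).natDegree

/-- The factorization indices `κ_j = k_j - deg q_j - k`. -/
def MiddleForm.index {m : ℕ} {Ω : Matrix (Fin m) (Fin m) (RatFunc ℂ)}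
    {F : WienerHopfFactorization Ω} (M : MiddleForm F) (j : Fin m) : ℤ :=
  (M.e j : ℤ) - (M.q j).natDegree - F.k

/-- The matrix function `z^n Ω(z)`, for an integer `n`. -/
def shift {m : ℕ} (n : ℤ) (Ω : Matrix (Fin m) (Fin m) (RatFunc ℂ)) :
    Matrix (Fin m) (Fin m) (RatFunc ℂ) :=
  (RatFunc.X : RatFunc ℂ) ^ n • Ω

end RatToeplitz

end

noncomputable section

namespace RatToeplitz

open MeasureTheory AddCircle Polynomial

/-! ### Rational functions with prescribed poles -/

/-! The special form lets the triangular middle factor be replaced by a diagonal one. Pulling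
`z^{κ_j}` out of column `j` and `z^{deg q_i} / q_i` out of row `i` of `Ξ` leaves a lower triangular
matrix `U` with unit diagonal. Its entries have poles only at 0, and the special form says exactly
that they are proper. Since `det U = 1`, the inverse `U⁻¹` is of the same kind. Hence `z^n Ω = B
diag(z^{s_j}) Ω₊` with `s_j = κ_j + n` and `B = Ω₋ diag(z^{deg q_i} / q_i) U`. Here `B` is proper
and may have poles on the circle, while `C = B⁻¹` is a minus function
(`MiddleForm.exists_diagonalFactorization`).

For such a product, `g` is in the range of the operator exactly when the Fourier coefficients of `(C
g)_j` with index in `[0, s_j)` vanish (`DiagonalFactorization.range_eq_ker`). These functionals are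
jointly surjective (`coeffMap_surjective`), so the codimension is `∑ max(κ_j + n, 0)`, and its
second difference in `n` counts the indices equal to a given integer. Moreover, the operator
determines its symbol by its values on suitable polynomial vectors (`eq_of_toeplitz_eq`), so the
same counting formula gives the uniqueness of the indices.

The analysis rests on one fact: an `L^p` function whose product with `z - a` has a one-sided Fourier
series is itself one-sided if `a` lies on the proper side of the circle or on it, because its
remaining coefficients grow in modulus and yet tend to 0. If `a` lies on the wrong side for `H^p`,
the error is a multiple of `1/(z - a)`. So every function to which the Riesz projection is applied
splits explicitly. -/

theorem isPole_div_imp {N q : ℂ[X]} {z : ℂ}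
    (h : IsPole (algebraMap ℂ[X] (RatFunc ℂ) N / algebraMap ℂ[X] (RatFunc ℂ) q) z) :
    q.IsRoot z :=
  h.dvd (RatFunc.denom_div_dvd N q)

/-- Cross-multiplication with the reduced fraction. Properness, defined through the reduced
fraction, can then be read off from any representation. -/
theorem degree_add_degree_denom {N q : ℂ[X]} (hq : q ≠ 0) {r : RatFunc ℂ}
    (hr : r = algebraMap ℂ[X] (RatFunc ℂ) N / algebraMap ℂ[X] (RatFunc ℂ) q) :
    N.degree + r.denom.degree = r.num.degree + q.degree := by
  rw [← degree_mul, ← degree_mul]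
  congr 1
  have hd' : algebraMap ℂ[X] (RatFunc ℂ) r.denom ≠ 0 :=
    RatFunc.algebraMap_ne_zero r.denom_ne_zero
  apply RatFunc.algebraMap_injective ℂ
  have h := (RatFunc.num_div_denom r).trans hr
  rw [div_eq_div_iff hd' (RatFunc.algebraMap_ne_zero hq)] at h
  rw [map_mul, map_mul, h]

theorem isProper_div_iff {N q : ℂ[X]} (hq : q ≠ 0) :
    IsProper (algebraMap ℂ[X] (RatFunc ℂ) N / algebraMap ℂ[X] (RatFunc ℂ) q) ↔
      N.degree ≤ q.degree := by
  have h := degree_add_degree_denom (N := N) hq rfl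
  set r := algebraMap ℂ[X] (RatFunc ℂ) N / algebraMap ℂ[X] (RatFunc ℂ) q with hr
  have hd : r.denom.degree = (r.denom.natDegree : WithBot ℕ) :=
    degree_eq_natDegree r.denom_ne_zero
  have hq' : q.degree = (q.natDegree : WithBot ℕ) := degree_eq_natDegree hq
  unfold IsProper
  rw [hd] at h ⊢
  rw [hq'] at h ⊢
  by_cases hN : N = 0
  · simp [hr, hN]
  · have hn : r.num ≠ 0 := by
      refine RatFunc.num_ne_zero ?_
      rw [hr]
      exact div_ne_zero (RatFunc.algebraMap_ne_zero hN) (RatFunc.algebraMap_ne_zero hq)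
    rw [degree_eq_natDegree hN, degree_eq_natDegree hn] at h ⊢
    norm_cast at h ⊢
    omega

theorem isStrictlyProper_div_iff {N q : ℂ[X]} (hq : q ≠ 0) :
    IsStrictlyProper (algebraMap ℂ[X] (RatFunc ℂ) N / algebraMap ℂ[X] (RatFunc ℂ) q) ↔
      N.degree < q.degree := by
  have h := degree_add_degree_denom (N := N) hq rfl
  set r := algebraMap ℂ[X] (RatFunc ℂ) N / algebraMap ℂ[X] (RatFunc ℂ) q with hr
  have hd : r.denom.degree = (r.denom.natDegree : WithBot ℕ) :=
    degree_eq_natDegree r.denom_ne_zero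
  have hq' : q.degree = (q.natDegree : WithBot ℕ) := degree_eq_natDegree hq
  unfold IsStrictlyProper
  rw [hd] at h ⊢
  rw [hq'] at h ⊢
  by_cases hN : N = 0
  · simp [hr, hN]
  · have hn : r.num ≠ 0 := by
      refine RatFunc.num_ne_zero ?_
      rw [hr]
      exact div_ne_zero (RatFunc.algebraMap_ne_zero hN) (RatFunc.algebraMap_ne_zero hq)
    rw [degree_eq_natDegree hN, degree_eq_natDegree hn] at h ⊢
    norm_cast at h ⊢
    omega

/-- `r = N / q`, where `q` has its zeroes in `U`. -/
def IsFraction (U : Set ℂ) (r : RatFunc ℂ) (N q : ℂ[X]) : Prop :=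
  q ≠ 0 ∧ (∀ z, q.IsRoot z → z ∈ U) ∧
    r = algebraMap ℂ[X] (RatFunc ℂ) N / algebraMap ℂ[X] (RatFunc ℂ) q

theorem isFraction_num_denom {U : Set ℂ} {r : RatFunc ℂ} (h : ∀ z, IsPole r z → z ∈ U) :
    IsFraction U r r.num r.denom :=
  ⟨r.denom_ne_zero, h, (RatFunc.num_div_denom r).symm⟩

namespace IsFraction

variable {U : Set ℂ} {r s : RatFunc ℂ} {N N' q q' : ℂ[X]}

theorem poles (h : IsFraction U r N q) : ∀ z, IsPole r z → z ∈ U := fun z hz =>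
  h.2.1 z (isPole_div_imp (h.2.2 ▸ hz))

theorem proper_iff (h : IsFraction U r N q) : IsProper r ↔ N.degree ≤ q.degree := by
  rw [h.2.2, isProper_div_iff h.1]

theorem strictlyProper_iff (h : IsFraction U r N q) :
    IsStrictlyProper r ↔ N.degree < q.degree := by
  rw [h.2.2, isStrictlyProper_div_iff h.1]

theorem add (h : IsFraction U r N q) (h' : IsFraction U s N' q') :
    IsFraction U (r + s) (N * q' + q * N') (q * q') := by
  refine ⟨mul_ne_zero h.1 h'.1, fun z hz => ?_, ?_⟩
  · exact (root_mul.1 hz).elim (h.2.1 z) (h'.2.1 z)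
  · rw [h.2.2, h'.2.2, div_add_div _ _ (RatFunc.algebraMap_ne_zero h.1)
      (RatFunc.algebraMap_ne_zero h'.1)]
    simp only [map_add, map_mul]

theorem mul (h : IsFraction U r N q) (h' : IsFraction U s N' q') :
    IsFraction U (r * s) (N * N') (q * q') := by
  refine ⟨mul_ne_zero h.1 h'.1, fun z hz => ?_, ?_⟩
  · exact (root_mul.1 hz).elim (h.2.1 z) (h'.2.1 z)
  · rw [h.2.2, h'.2.2, div_mul_div_comm]
    simp only [map_mul]

theorem algebraMap (U : Set ℂ) (N : ℂ[X]) :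
    IsFraction U (algebraMap ℂ[X] (RatFunc ℂ) N) N 1 :=
  ⟨one_ne_zero, fun z hz => by simp at hz, by simp⟩

end IsFraction

/-- The rational functions with all finite poles in `U`. -/
def polesIn (U : Set ℂ) : Subring (RatFunc ℂ) where
  carrier := {r | ∀ z, IsPole r z → z ∈ U}
  zero_mem' := by simpa using (IsFraction.algebraMap U 0).poles
  one_mem' := by simpa using (IsFraction.algebraMap U 1).poles
  add_mem' h h' := ((isFraction_num_denom h).add (isFraction_num_denom h')).poles
  mul_mem' h h' := ((isFraction_num_denom h).mul (isFraction_num_denom h')).poles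
  neg_mem' {r} h := by
    simpa using ((IsFraction.algebraMap U (-1)).mul (isFraction_num_denom h)).poles

/-- The proper rational functions with all poles in `U`. -/
def properIn (U : Set ℂ) : Subring (RatFunc ℂ) where
  carrier := {r | (∀ z, IsPole r z → z ∈ U) ∧ IsProper r}
  zero_mem' := ⟨(polesIn U).zero_mem, by simp [IsProper]⟩
  one_mem' := ⟨(polesIn U).one_mem, by simp [IsProper]⟩
  add_mem' {r s} h h' := by
    refine ⟨(polesIn U).add_mem h.1 h'.1, ?_⟩
    rw [((isFraction_num_denom h.1).add (isFraction_num_denom h'.1)).proper_iff, degree_mul]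
    refine (degree_add_le _ _).trans (max_le ?_ ?_)
    · rw [degree_mul]; exact add_le_add_left h.2 _
    · rw [degree_mul]; exact add_le_add_right h'.2 _
  mul_mem' {r s} h h' := by
    refine ⟨(polesIn U).mul_mem h.1 h'.1, ?_⟩
    rw [((isFraction_num_denom h.1).mul (isFraction_num_denom h'.1)).proper_iff, degree_mul,
      degree_mul]
    exact add_le_add h.2 h'.2
  neg_mem' {r} h := by
    refine ⟨(polesIn U).neg_mem h.1, ?_⟩
    have := ((IsFraction.algebraMap U (-1)).mul (isFraction_num_denom h.1)).proper_iff
    simp only [map_neg, map_one, neg_mul, one_mul, degree_neg] at this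
    exact this.2 h.2

/-- The strictly proper rational functions with all poles in `U`. -/
def strictIn (U : Set ℂ) : AddSubgroup (RatFunc ℂ) where
  carrier := {r | (∀ z, IsPole r z → z ∈ U) ∧ IsStrictlyProper r}
  zero_mem' := ⟨(polesIn U).zero_mem, by simp [IsStrictlyProper]⟩
  add_mem' {r s} h h' := by
    refine ⟨(polesIn U).add_mem h.1 h'.1, ?_⟩
    rw [((isFraction_num_denom h.1).add (isFraction_num_denom h'.1)).strictlyProper_iff,
      degree_mul]
    refine (degree_add_le _ _).trans_lt (max_lt ?_ ?_)
    · rw [degree_mul]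
      exact WithBot.add_lt_add_right (degree_ne_bot.2 s.denom_ne_zero) h.2
    · rw [degree_mul]
      exact WithBot.add_lt_add_left (degree_ne_bot.2 r.denom_ne_zero) h'.2
  neg_mem' {r} h := by
    refine ⟨(polesIn U).neg_mem h.1, ?_⟩
    have := ((IsFraction.algebraMap U (-1)).mul (isFraction_num_denom h.1)).strictlyProper_iff
    simp only [map_neg, map_one, neg_mul, one_mul, degree_neg] at this
    exact this.2 h.2

/-- `strictIn U` is thus a module over the ring `properIn U`, so matrices over that ring act on
vectors of strictly proper functions. -/
theorem mul_mem_strictIn {U : Set ℂ} {r s : RatFunc ℂ} (h : r ∈ properIn U)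
    (h' : s ∈ strictIn U) : r * s ∈ strictIn U := by
  refine ⟨(polesIn U).mul_mem h.1 h'.1, ?_⟩
  rw [((isFraction_num_denom h.1).mul (isFraction_num_denom h'.1)).strictlyProper_iff,
    degree_mul, degree_mul]
  have h1 : r.num.degree + s.num.degree ≤ r.denom.degree + s.num.degree :=
    add_le_add_left h.2 _
  exact h1.trans_lt (WithBot.add_lt_add_left (degree_ne_bot.2 r.denom_ne_zero) h'.2)

theorem properIn_mono {U V : Set ℂ} (h : U ⊆ V) {r : RatFunc ℂ} (hr : r ∈ properIn U) :
    r ∈ properIn V :=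
  ⟨fun z hz => h (hr.1 z hz), hr.2⟩

theorem strictIn_mono {U V : Set ℂ} (h : U ⊆ V) {r : RatFunc ℂ} (hr : r ∈ strictIn U) :
    r ∈ strictIn V :=
  ⟨fun z hz => h (hr.1 z hz), hr.2⟩

theorem div_mem_properIn {U : Set ℂ} {N q : ℂ[X]} (hq : q ≠ 0)
    (hU : ∀ z, q.IsRoot z → z ∈ U) (h : N.degree ≤ q.degree) :
    algebraMap ℂ[X] (RatFunc ℂ) N / algebraMap ℂ[X] (RatFunc ℂ) q ∈ properIn U :=
  have hf : IsFraction U _ N q := ⟨hq, hU, rfl⟩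
  ⟨hf.poles, hf.proper_iff.2 h⟩

theorem div_mem_strictIn {U : Set ℂ} {N q : ℂ[X]} (hq : q ≠ 0)
    (hU : ∀ z, q.IsRoot z → z ∈ U) (h : N.degree < q.degree) :
    algebraMap ℂ[X] (RatFunc ℂ) N / algebraMap ℂ[X] (RatFunc ℂ) q ∈ strictIn U :=
  have hf : IsFraction U _ N q := ⟨hq, hU, rfl⟩
  ⟨hf.poles, hf.strictlyProper_iff.2 h⟩

theorem C_mem_properIn (U : Set ℂ) (c : ℂ) : RatFunc.C c ∈ properIn U := by
  have := div_mem_properIn (U := U) (N := C c) one_ne_zero (fun z hz => by simp at hz)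
    (by simpa using degree_C_le)
  simpa using this

/-- Polynomial part and strictly proper part. -/
theorem exists_polynomial_add_strict {U : Set ℂ} {r : RatFunc ℂ} (hr : r ∈ polesIn U) :
    ∃ g : ℂ[X], ∃ w ∈ strictIn U, r = algebraMap ℂ[X] (RatFunc ℂ) g + w := by
  refine ⟨r.num / r.denom, _, div_mem_strictIn (N := r.num % r.denom) r.denom_ne_zero hr
    (EuclideanDomain.mod_lt _ r.denom_ne_zero), ?_⟩
  have hd := RatFunc.algebraMap_ne_zero r.denom_ne_zero
  conv_lhs => rw [← RatFunc.num_div_denom r, ← EuclideanDomain.div_add_mod r.num r.denom]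
  rw [map_add, map_mul, add_div, mul_div_cancel_left₀ _ hd]

/-- A polynomial over `ℂ` can be built from constants by multiplication with linear factors. -/
theorem induction_on_roots {motive : ℂ[X] → Prop} (const : ∀ c : ℂ, c ≠ 0 → motive (C c))
    (mul : ∀ (a : ℂ) (q : ℂ[X]), q ≠ 0 → motive q → motive ((X - C a) * q))
    {q : ℂ[X]} (hq : q ≠ 0) : motive q := by
  induction h : q.natDegree generalizing q with
  | zero =>
    rw [eq_C_of_natDegree_eq_zero h] at hq ⊢
    exact const _ fun h0 => hq (by rw [h0, C_0])
  | succ n ih =>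
    obtain ⟨a, ha⟩ := IsAlgClosed.exists_root q (by
      rw [degree_eq_natDegree hq, h]
      exact_mod_cast Nat.succ_ne_zero n)
    obtain ⟨q', rfl⟩ := dvd_iff_isRoot.2 ha
    have hq' : q' ≠ 0 := right_ne_zero_of_mul hq
    refine mul a q' hq' (ih hq' ?_)
    rw [natDegree_mul (X_sub_C_ne_zero a) hq', natDegree_X_sub_C] at h
    omega

theorem exists_split (U : Set ℂ) (q : ℂ[X]) (hq : q ≠ 0) :
    ∃ q₁ q₂ : ℂ[X], q = q₁ * q₂ ∧ (∀ z, q₁.IsRoot z → z ∈ U) ∧ ∀ z, q₂.IsRoot z → z ∉ U := by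
  refine induction_on_roots (motive := fun q => ∃ q₁ q₂ : ℂ[X], q = q₁ * q₂ ∧
    (∀ z, q₁.IsRoot z → z ∈ U) ∧ ∀ z, q₂.IsRoot z → z ∉ U) (fun c hc => ?_) (fun a q hq ih => ?_) hq
  · exact ⟨1, C c, by simp, fun z hz => by simp at hz, fun z hz => by simp [hc] at hz⟩
  · obtain ⟨q₁, q₂, rfl, h1, h2⟩ := ih
    by_cases ha : a ∈ U
    · refine ⟨(X - C a) * q₁, q₂, by ring, fun z hz => ?_, h2⟩
      rcases root_mul.1 hz with hz | hz
      · rwa [← root_X_sub_C.1 hz]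
      · exact h1 z hz
    · refine ⟨q₁, (X - C a) * q₂, by ring, h1, fun z hz => ?_⟩
      rcases root_mul.1 hz with hz | hz
      · rwa [← root_X_sub_C.1 hz]
      · exact h2 z hz

/-- Partial fractions with respect to a partition of the set of poles. -/
theorem exists_add_of_mem_strictIn {U : Set ℂ} (V : Set ℂ) {r : RatFunc ℂ}
    (hr : r ∈ strictIn U) :
    ∃ u ∈ strictIn (U ∩ V), ∃ v ∈ strictIn (U \ V), r = u + v := by
  obtain ⟨q₁, q₂, hq, h1, h2⟩ := exists_split V r.denom r.denom_ne_zero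
  have hq0 := r.denom_ne_zero
  rw [hq] at hq0
  have hq1 : q₁ ≠ 0 := left_ne_zero_of_mul hq0
  have hq2 : q₂ ≠ 0 := right_ne_zero_of_mul hq0
  have hU : ∀ z, (q₁ * q₂).IsRoot z → z ∈ U := fun z hz => hr.1 z (by rwa [IsPole, hq])
  -- A nonunit common divisor would have a root both inside and outside `V`.
  have hcop : IsCoprime q₁ q₂ := by
    refine IsCoprime.symm ?_
    rw [← EuclideanDomain.gcd_isUnit_iff]
    by_contra hu
    obtain ⟨a, ha⟩ := IsAlgClosed.exists_root (EuclideanDomain.gcd q₂ q₁)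
      fun h0 => hu (isUnit_iff_degree_eq_zero.2 h0)
    exact h2 a (ha.dvd (EuclideanDomain.gcd_dvd_left _ _))
      (h1 a (ha.dvd (EuclideanDomain.gcd_dvd_right _ _)))
  obtain ⟨a, b, hab⟩ := hcop
  have ha1 := RatFunc.algebraMap_ne_zero hq1
  have ha2 := RatFunc.algebraMap_ne_zero hq2
  have hu : algebraMap ℂ[X] (RatFunc ℂ) (r.num * b % q₁) / algebraMap ℂ[X] (RatFunc ℂ) q₁ ∈
      strictIn (U ∩ V) :=
    div_mem_strictIn hq1 (fun z hz => ⟨hU z (root_mul_right_of_isRoot _ hz), h1 z hz⟩)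
      (EuclideanDomain.mod_lt _ hq1)
  refine ⟨_, hu, _, ?_, (add_sub_cancel _ _).symm⟩
  -- In the Bézout splitting `r.num = r.num * a * q₁ + r.num * b * q₂`, the factor `r.num * b` is
  -- reduced modulo `q₁` and its quotient is moved to the other numerator.
  set N := r.num * a + (r.num * b / q₁) * q₂ with hN
  have hr' : r - algebraMap ℂ[X] (RatFunc ℂ) (r.num * b % q₁) / algebraMap ℂ[X] (RatFunc ℂ) q₁ =
      algebraMap ℂ[X] (RatFunc ℂ) N / algebraMap ℂ[X] (RatFunc ℂ) q₂ := by
    have hdm := EuclideanDomain.div_add_mod (r.num * b) q₁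
    have key : r.num = N * q₁ + (r.num * b % q₁) * q₂ := by
      rw [hN]
      linear_combination (-r.num) * hab - q₂ * hdm
    have hk := congrArg (algebraMap ℂ[X] (RatFunc ℂ)) key
    simp only [map_add, map_mul] at hk
    rw [sub_eq_iff_eq_add, div_add_div _ _ ha2 ha1]
    conv_lhs => rw [← RatFunc.num_div_denom r, hk, hq, map_mul]
    congr 1 <;> ring
  refine ⟨?_, ?_⟩
  · intro z hz
    rw [hr'] at hz
    have := isPole_div_imp hz
    exact ⟨hU z (root_mul_left_of_isRoot _ this), h2 z this⟩
  -- No degree bound for `N` is needed: this is a difference of strictly proper functions.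
  · exact ((strictIn U).sub_mem hr (strictIn_mono Set.inter_subset_left hu)).2

end RatToeplitz

end

noncomputable section

namespace RatToeplitz

open MeasureTheory AddCircle Polynomial

/-! ### Rational functions as measurable functions on the circle -/

/-- The ring of measurable functions on the circle, up to almost everywhere equality. -/
abbrev MeasCircle : Type := UnitAddCircle →ₘ[(haarAddCircle : Measure UnitAddCircle)] ℂ

/-- Products with rational functions having poles on the circle may leave `L^p`. The algebra
therefore takes place in this ring, and membership in `L^p` is tracked separately. -/
instance : CommRing MeasCircle :=
  { (inferInstance : AddCommGroup MeasCircle), (inferInstance : CommMonoid MeasCircle) with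
    left_distrib := fun x y z => AEEqFun.ext (by
      filter_upwards [AEEqFun.coeFn_mul x (y + z), AEEqFun.coeFn_add y z,
        AEEqFun.coeFn_add (x * y) (x * z), AEEqFun.coeFn_mul x y, AEEqFun.coeFn_mul x z]
        with t h1 h2 h3 h4 h5
      exact h1.trans (by simp only [Pi.mul_apply, h2, h3, Pi.add_apply, h4, h5, mul_add]))
    right_distrib := fun x y z => AEEqFun.ext (by
      filter_upwards [AEEqFun.coeFn_mul (x + y) z, AEEqFun.coeFn_add x y,
        AEEqFun.coeFn_add (x * z) (y * z), AEEqFun.coeFn_mul x z, AEEqFun.coeFn_mul y z]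
        with t h1 h2 h3 h4 h5
      exact h1.trans (by simp only [Pi.mul_apply, h2, h3, Pi.add_apply, h4, h5, add_mul]))
    zero_mul := fun x => AEEqFun.ext (by
      filter_upwards [AEEqFun.coeFn_mul 0 x,
        AEEqFun.coeFn_zero (α := UnitAddCircle) (β := ℂ) (μ := haarAddCircle)] with t h1 h2
      exact h1.trans (by simp only [Pi.mul_apply, h2, Pi.zero_apply, zero_mul]))
    mul_zero := fun x => AEEqFun.ext (by
      filter_upwards [AEEqFun.coeFn_mul x 0,
        AEEqFun.coeFn_zero (α := UnitAddCircle) (β := ℂ) (μ := haarAddCircle)] with t h1 h2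
      exact h1.trans (by simp only [Pi.mul_apply, h2, Pi.zero_apply, mul_zero])) }

theorem continuous_eval_toCircle (q : ℂ[X]) :
    Continuous fun t : UnitAddCircle => q.eval (toCircle t : ℂ) :=
  q.continuous.comp (continuous_subtype_val.comp continuous_toCircle)

theorem measurable_onCircle (r : RatFunc ℂ) : Measurable (onCircle r) :=
  (continuous_eval_toCircle r.num).measurable.div (continuous_eval_toCircle r.denom).measurable

theorem onCircle_mul (r s : RatFunc ℂ) :
    ∀ᵐ t ∂(haarAddCircle : Measure UnitAddCircle),
      onCircle (r * s) t = onCircle r t * onCircle s t := by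
  filter_upwards [ae_not_isPole r, ae_not_isPole s] with t hr hs
  exact RatFunc.eval_mul (f := RingHom.id ℂ) (a := (toCircle t : ℂ)) hr hs

/-- A rational function, as a measurable function on the circle. -/
def ratToMeas : RatFunc ℂ →+* MeasCircle where
  toFun r := AEEqFun.mk (onCircle r) (measurable_onCircle r).aestronglyMeasurable
  map_zero' := AEEqFun.mk_eq_mk.2 (.of_forall fun t => by simp [onCircle])
  map_one' := AEEqFun.mk_eq_mk.2 (.of_forall fun t => by simp [onCircle])
  map_add' r s := by
    rw [AEEqFun.mk_add_mk]
    exact AEEqFun.mk_eq_mk.2 (onCircle_add r s)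
  map_mul' r s := by
    rw [AEEqFun.mk_mul_mk]
    exact AEEqFun.mk_eq_mk.2 (onCircle_mul r s)

theorem coeFn_ratToMeas (r : RatFunc ℂ) :
    ratToMeas r =ᵐ[(haarAddCircle : Measure UnitAddCircle)] onCircle r :=
  AEEqFun.coeFn_mk _ _

theorem ratToMeas_C_mul (c : ℂ) (x : MeasCircle) : ratToMeas (RatFunc.C c) * x = c • x := by
  refine AEEqFun.ext ?_
  filter_upwards [AEEqFun.coeFn_mul (ratToMeas (RatFunc.C c)) x, AEEqFun.coeFn_smul c x,
    coeFn_ratToMeas (RatFunc.C c)] with t h1 h2 h3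
  rw [h1, h2, Pi.mul_apply, h3, onCircle, RatFunc.eval_C]
  rfl

variable {p : ℝ≥0∞} [Fact (1 ≤ p)]

omit [Fact (1 ≤ p)] in
theorem one_mem_Lp : (1 : MeasCircle) ∈ Lp ℂ p (haarAddCircle : Measure UnitAddCircle) := by
  rw [AEEqFun.one_def, Lp.mem_Lp_iff_memLp]
  exact (memLp_congr_ae (AEEqFun.coeFn_mk _ _)).2 (memLp_const (1 : ℂ))

omit [Fact (1 ≤ p)] in
-- Without poles on the circle, `r` is continuous there and hence a bounded multiplier.
theorem ratToMeas_mul_mem_Lp {r : RatFunc ℂ} (hr : r ∈ polesIn {z | ‖z‖ ≠ 1}) {x : MeasCircle}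
    (hx : x ∈ Lp ℂ p (haarAddCircle : Measure UnitAddCircle)) :
    ratToMeas r * x ∈ Lp ℂ p (haarAddCircle : Measure UnitAddCircle) := by
  have hc : Continuous (onCircle r) :=
    (continuous_eval_toCircle r.num).div (continuous_eval_toCircle r.denom) fun t ht =>
      hr _ ht (Circle.norm_coe _)
  have hae : (ratToMeas r * x : MeasCircle) =ᵐ[haarAddCircle] fun t => onCircle r t * x t := by
    filter_upwards [AEEqFun.coeFn_mul (ratToMeas r) x, coeFn_ratToMeas r] with t h1 h2
    rw [h1, Pi.mul_apply, h2]
  rw [Lp.mem_Lp_iff_memLp, memLp_congr_ae hae]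
  refine (Lp.mem_Lp_iff_memLp.1 hx).of_le_mul
    (c := ‖(⟨onCircle r, hc⟩ : C(UnitAddCircle, ℂ))‖)
    ((measurable_onCircle r).aestronglyMeasurable.mul x.aestronglyMeasurable)
    (.of_forall fun t => ?_)
  rw [norm_mul]
  exact mul_le_mul_of_nonneg_right
    ((⟨onCircle r, hc⟩ : C(UnitAddCircle, ℂ)).norm_coe_le_norm t) (norm_nonneg _)

omit [Fact (1 ≤ p)] in
theorem ratToMeas_mem_Lp {r : RatFunc ℂ} (hr : r ∈ polesIn {z | ‖z‖ ≠ 1}) :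
    ratToMeas r ∈ Lp ℂ p (haarAddCircle : Measure UnitAddCircle) := by
  simpa using ratToMeas_mul_mem_Lp hr one_mem_Lp

theorem algebraMap_mem_polesIn (U : Set ℂ) (q : ℂ[X]) :
    algebraMap ℂ[X] (RatFunc ℂ) q ∈ polesIn U :=
  (IsFraction.algebraMap U q).poles

theorem fourierCoeff_add_meas {x y : MeasCircle}
    (hx : x ∈ Lp ℂ p (haarAddCircle : Measure UnitAddCircle))
    (hy : y ∈ Lp ℂ p (haarAddCircle : Measure UnitAddCircle)) (n : ℤ) :
    fourierCoeff (x + y : MeasCircle) n = fourierCoeff x n + fourierCoeff y n :=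
  fourierCoeff_add_coe (⟨x, hx⟩ : LpCircle p) ⟨y, hy⟩ n

theorem fourierCoeff_smul_meas (c : ℂ) (x : MeasCircle) (n : ℤ) :
    fourierCoeff (c • x : MeasCircle) n = c * fourierCoeff x n := by
  rw [fourierCoeff_congr_ae (AEEqFun.coeFn_smul c x), fourierCoeff.const_smul, smul_eq_mul]

theorem ratToMeas_X_zpow (s : ℤ) :
    (ratToMeas (RatFunc.X ^ s) : UnitAddCircle → ℂ) =ᵐ[haarAddCircle] fourier s := by
  have hnat : ∀ n : ℕ, ∀ t, onCircle (RatFunc.X ^ n) t = (toCircle t : ℂ) ^ n := fun n t => by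
    rw [onCircle, ← RatFunc.algebraMap_X, ← map_pow, RatFunc.eval_algebraMap]
    simp
  have hf : ∀ (n : ℕ) (t : UnitAddCircle), fourier (n : ℤ) t = (toCircle t : ℂ) ^ n :=
    fun n t => by
      rw [fourier_apply, toCircle_zsmul, zpow_natCast, Circle.coe_pow]
  obtain ⟨n, rfl | rfl⟩ := s.eq_nat_or_neg
  · filter_upwards [coeFn_ratToMeas (RatFunc.X ^ (n : ℤ))] with t ht
    rw [ht, zpow_natCast, hnat, hf]
  · have h1 : ratToMeas (RatFunc.X ^ (-(n : ℤ))) * ratToMeas (RatFunc.X ^ n) = 1 := by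
      rw [← map_mul, zpow_neg, zpow_natCast,
        inv_mul_cancel₀ (pow_ne_zero n RatFunc.X_ne_zero), map_one]
    filter_upwards [coeFn_ratToMeas (RatFunc.X ^ n), AEEqFun.coeFn_one (β := ℂ) (μ := haarAddCircle),
      AEEqFun.coeFn_mul (ratToMeas (RatFunc.X ^ (-(n : ℤ)))) (ratToMeas (RatFunc.X ^ n))]
      with t h2 h3 h4
    rw [h1, h3, Pi.mul_apply, h2, hnat, ← hf] at h4
    have h5 : fourier (-(n : ℤ)) t * fourier (n : ℤ) t = 1 := by
      rw [← fourier_add, neg_add_cancel, fourier_zero]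
    have h6 : (fourier (n : ℤ) t : ℂ) ≠ 0 := right_ne_zero_of_mul_eq_one h5
    exact mul_right_cancel₀ h6 (h4.symm.trans h5.symm)

theorem fourierCoeff_X_zpow_mul (s : ℤ) (x : MeasCircle) (n : ℤ) :
    fourierCoeff (ratToMeas (RatFunc.X ^ s) * x : MeasCircle) n = fourierCoeff x (n - s) := by
  refine integral_congr_ae ?_
  filter_upwards [AEEqFun.coeFn_mul (ratToMeas (RatFunc.X ^ s)) x, ratToMeas_X_zpow s]
    with t h1 h2
  rw [h1, Pi.mul_apply, h2, smul_eq_mul, smul_eq_mul, ← mul_assoc, ← fourier_add]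
  congr 3
  ring

/-- This two-term recurrence is the source of all the results on division by polynomials. -/
theorem fourierCoeff_linear_mul (a : ℂ) {x : MeasCircle}
    (hx : x ∈ Lp ℂ p (haarAddCircle : Measure UnitAddCircle)) (n : ℤ) :
    fourierCoeff (ratToMeas (algebraMap ℂ[X] (RatFunc ℂ) (X - C a)) * x : MeasCircle) n =
      fourierCoeff x (n - 1) - a * fourierCoeff x n := by
  have h : ratToMeas (algebraMap ℂ[X] (RatFunc ℂ) (X - C a)) * x =
      ratToMeas (RatFunc.X ^ (1 : ℤ)) * x + (-a) • x := by
    rw [← ratToMeas_C_mul, ← add_mul, ← map_add]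
    simp [sub_eq_add_neg]
  have h1 : ratToMeas (RatFunc.X ^ (1 : ℤ)) * x ∈
      Lp ℂ p (haarAddCircle : Measure UnitAddCircle) := by
    have := ratToMeas_mul_mem_Lp (algebraMap_mem_polesIn {z | ‖z‖ ≠ 1} X) hx
    simpa using this
  have h2 : (-a) • x ∈ Lp ℂ p (haarAddCircle : Measure UnitAddCircle) :=
    Lp.const_smul_mem_Lp (-a) (⟨x, hx⟩ : LpCircle p)
  rw [h, fourierCoeff_add_meas h1 h2, fourierCoeff_X_zpow_mul, fourierCoeff_smul_meas]
  ring

/-- The Riemann-Lebesgue lemma on the circle. -/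
theorem tendsto_fourierCoeff_cofinite (f : UnitAddCircle → ℂ) :
    Filter.Tendsto (fourierCoeff f) Filter.cofinite (nhds 0) := by
  -- The coefficients are the values at the integers of the Fourier transform on `ℝ` of the function
  -- cut off to one period.
  have h := Real.zero_at_infty_fourier
    ((Set.Ioc (0 : ℝ) 1).indicator fun v : ℝ => f (v : UnitAddCircle))
  refine (h.comp Int.tendsto_coe_cofinite).congr fun n => ?_
  rw [Function.comp_apply, Real.fourier_real_eq_integral_exp_smul,
    fourierCoeff_eq_intervalIntegral f n 0, intervalIntegral.integral_of_le (by norm_num),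
    ← integral_indicator measurableSet_Ioc, zero_add]
  simp only [ne_eq, one_ne_zero, not_false_eq_true, div_self, one_smul]
  congr 1
  funext v
  by_cases hv : v ∈ Set.Ioc (0 : ℝ) 1
  · rw [Set.indicator_of_mem hv, Set.indicator_of_mem hv, fourier_coe_apply]
    congr 2
    push_cast
    ring
  · rw [Set.indicator_of_notMem hv, Set.indicator_of_notMem hv, smul_zero]

/-! ### Spaces of functions with one-sided Fourier series -/

variable (p) in
/-- The functions in `L^p` with Fourier coefficients only of index `n < k`. -/
def lowPart (k : ℤ) : AddSubgroup MeasCircle where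
  carrier := {x | x ∈ Lp ℂ p (haarAddCircle : Measure UnitAddCircle) ∧
    ∀ n, k ≤ n → fourierCoeff x n = 0}
  zero_mem' := ⟨zero_mem _, fun n _ => fourierCoeff_zero_coe (p := p) n⟩
  add_mem' h h' := ⟨add_mem h.1 h'.1, fun n hn => by
    rw [fourierCoeff_add_meas h.1 h'.1, h.2 n hn, h'.2 n hn, add_zero]⟩
  neg_mem' {x} h := ⟨neg_mem h.1, fun n hn => by
    rw [← neg_one_smul ℂ x, fourierCoeff_smul_meas, h.2 n hn, mul_zero]⟩

variable (p) in
/-- The functions in `L^p` with Fourier coefficients only of index `n ≥ k`. -/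
def highPart (k : ℤ) : AddSubgroup MeasCircle where
  carrier := {x | x ∈ Lp ℂ p (haarAddCircle : Measure UnitAddCircle) ∧
    ∀ n, n < k → fourierCoeff x n = 0}
  zero_mem' := ⟨zero_mem _, fun n _ => fourierCoeff_zero_coe (p := p) n⟩
  add_mem' h h' := ⟨add_mem h.1 h'.1, fun n hn => by
    rw [fourierCoeff_add_meas h.1 h'.1, h.2 n hn, h'.2 n hn, add_zero]⟩
  neg_mem' {x} h := ⟨neg_mem h.1, fun n hn => by
    rw [← neg_one_smul ℂ x, fourierCoeff_smul_meas, h.2 n hn, mul_zero]⟩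

theorem lowPart_mono {k l : ℤ} (h : k ≤ l) : lowPart p k ≤ lowPart p l :=
  fun _ hx => ⟨hx.1, fun n hn => hx.2 n (h.trans hn)⟩

/-- For `n ≥ k` the coefficients satisfy `c_{n-1} = a c_n` with `|a| ≤ 1`. So `|c_n|` is
nondecreasing from index `k - 1` on, while it tends to 0 by Riemann-Lebesgue. The case `|a| = 1` is
included, which handles poles on the circle. -/
theorem mem_lowPart_of_linear_mul {a : ℂ} (ha : ‖a‖ ≤ 1) {x : MeasCircle}
    (hx : x ∈ Lp ℂ p (haarAddCircle : Measure UnitAddCircle)) {k : ℤ}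
    (h : ratToMeas (algebraMap ℂ[X] (RatFunc ℂ) (X - C a)) * x ∈ lowPart p k) :
    x ∈ lowPart p (k - 1) := by
  refine ⟨hx, fun n hn => ?_⟩
  have hle : ∀ j : ℕ, ‖fourierCoeff x n‖ ≤ ‖fourierCoeff x (n + j)‖ := by
    intro j
    induction j with
    | zero => simp
    | succ j ih =>
      have h1 := h.2 (n + (j + 1 : ℕ)) (by push_cast; omega)
      rw [fourierCoeff_linear_mul a hx, sub_eq_zero] at h1
      have h2 : n + ((j + 1 : ℕ) : ℤ) - 1 = n + j := by push_cast; ring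
      rw [h2] at h1
      rw [h1, norm_mul] at ih
      exact ih.trans (mul_le_of_le_one_left (norm_nonneg _) ha)
  have hlim : Filter.Tendsto (fun j : ℕ => ‖fourierCoeff x (n + j)‖) Filter.atTop (nhds 0) := by
    have hinj : Function.Injective fun j : ℕ => n + (j : ℤ) := fun i j hij => by simpa using hij
    have := (tendsto_fourierCoeff_cofinite x).comp
      (hinj.tendsto_cofinite.mono_left Nat.cofinite_eq_atTop.ge)
    simpa using this.norm
  exact norm_le_zero_iff.1 (ge_of_tendsto' hlim hle)

/-- The mirror image: below `k`, the moduli do not decrease as the index goes to `-∞`. Here the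
bound `k` stays the same. -/
theorem mem_highPart_of_linear_mul {a : ℂ} (ha : 1 ≤ ‖a‖) {x : MeasCircle}
    (hx : x ∈ Lp ℂ p (haarAddCircle : Measure UnitAddCircle)) {k : ℤ}
    (h : ratToMeas (algebraMap ℂ[X] (RatFunc ℂ) (X - C a)) * x ∈ highPart p k) :
    x ∈ highPart p k := by
  refine ⟨hx, fun n hn => ?_⟩
  have hle : ∀ j : ℕ, ‖fourierCoeff x n‖ ≤ ‖fourierCoeff x (n - j)‖ := by
    intro j
    induction j with
    | zero => simp
    | succ j ih =>
      have h1 := h.2 (n - j) (by omega)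
      rw [fourierCoeff_linear_mul a hx, sub_eq_zero] at h1
      have h2 : n - (j : ℤ) - 1 = n - (j + 1 : ℕ) := by push_cast; ring
      rw [h2] at h1
      rw [h1, norm_mul]
      exact ih.trans (le_mul_of_one_le_left (norm_nonneg _) ha)
  have hlim : Filter.Tendsto (fun j : ℕ => ‖fourierCoeff x (n - j)‖) Filter.atTop (nhds 0) := by
    have hinj : Function.Injective fun j : ℕ => n - (j : ℤ) := fun i j hij => by simpa using hij
    have := (tendsto_fourierCoeff_cofinite x).comp
      (hinj.tendsto_cofinite.mono_left Nat.cofinite_eq_atTop.ge)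
    simpa using this.norm
  exact norm_le_zero_iff.1 (ge_of_tendsto' hlim hle)

omit [Fact (1 ≤ p)] in
theorem polynomial_mul_mem_Lp (q : ℂ[X]) {x : MeasCircle}
    (hx : x ∈ Lp ℂ p (haarAddCircle : Measure UnitAddCircle)) :
    ratToMeas (algebraMap ℂ[X] (RatFunc ℂ) q) * x ∈
      Lp ℂ p (haarAddCircle : Measure UnitAddCircle) :=
  ratToMeas_mul_mem_Lp (algebraMap_mem_polesIn _ q) hx

theorem const_mul_mem_lowPart {c : ℂ} {x : MeasCircle} {k : ℤ} (hx : x ∈ lowPart p k) :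
    ratToMeas (algebraMap ℂ[X] (RatFunc ℂ) (C c)) * x ∈ lowPart p k := by
  refine ⟨polynomial_mul_mem_Lp _ hx.1, fun n hn => ?_⟩
  rw [RatFunc.algebraMap_C, ratToMeas_C_mul, fourierCoeff_smul_meas, hx.2 n hn, mul_zero]

theorem const_mul_mem_highPart {c : ℂ} {x : MeasCircle} {k : ℤ} (hx : x ∈ highPart p k) :
    ratToMeas (algebraMap ℂ[X] (RatFunc ℂ) (C c)) * x ∈ highPart p k := by
  refine ⟨polynomial_mul_mem_Lp _ hx.1, fun n hn => ?_⟩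
  rw [RatFunc.algebraMap_C, ratToMeas_C_mul, fourierCoeff_smul_meas, hx.2 n hn, mul_zero]

theorem polynomial_mul_mem_lowPart (q : ℂ[X]) {x : MeasCircle} {k : ℤ} (hx : x ∈ lowPart p k) :
    ratToMeas (algebraMap ℂ[X] (RatFunc ℂ) q) * x ∈ lowPart p (k + q.natDegree) := by
  by_cases hq : q = 0
  · simp [hq, zero_mem]
  refine induction_on_roots (motive := fun q => ratToMeas (algebraMap ℂ[X] (RatFunc ℂ) q) * x ∈
    lowPart p (k + q.natDegree)) (fun c _ => ?_) (fun a q hq ih => ?_) hq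
  · simpa using const_mul_mem_lowPart hx
  · rw [natDegree_mul (X_sub_C_ne_zero a) hq, natDegree_X_sub_C, map_mul, map_mul, mul_assoc]
    refine ⟨polynomial_mul_mem_Lp _ ih.1, fun n hn => ?_⟩
    push_cast at hn
    rw [fourierCoeff_linear_mul a ih.1, ih.2 _ (by omega), ih.2 _ (by omega), mul_zero, sub_zero]

theorem polynomial_mul_mem_highPart (q : ℂ[X]) {x : MeasCircle} {k : ℤ}
    (hx : x ∈ highPart p k) :
    ratToMeas (algebraMap ℂ[X] (RatFunc ℂ) q) * x ∈ highPart p k := by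
  by_cases hq : q = 0
  · simp [hq, zero_mem]
  refine induction_on_roots (motive := fun q => ratToMeas (algebraMap ℂ[X] (RatFunc ℂ) q) * x ∈
    highPart p k) (fun c _ => const_mul_mem_highPart hx) (fun a q hq ih => ?_) hq
  rw [map_mul, map_mul, mul_assoc]
  refine ⟨polynomial_mul_mem_Lp _ ih.1, fun n hn => ?_⟩
  rw [fourierCoeff_linear_mul a ih.1, ih.2 _ (by omega), ih.2 _ (by omega), mul_zero, sub_zero]

theorem const_mul_cancel {c : ℂ} (hc : c ≠ 0) (x : MeasCircle) :
    ratToMeas (algebraMap ℂ[X] (RatFunc ℂ) (C c⁻¹)) *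
      (ratToMeas (algebraMap ℂ[X] (RatFunc ℂ) (C c)) * x) = x := by
  rw [← mul_assoc, ← map_mul, ← map_mul, ← C_mul, inv_mul_cancel₀ hc]
  simp

theorem mem_lowPart_of_polynomial_mul {q : ℂ[X]} (hq : q ≠ 0) (hroots : ∀ z, q.IsRoot z → ‖z‖ ≤ 1)
    {x : MeasCircle} (hx : x ∈ Lp ℂ p (haarAddCircle : Measure UnitAddCircle)) {k : ℤ}
    (h : ratToMeas (algebraMap ℂ[X] (RatFunc ℂ) q) * x ∈ lowPart p k) :
    x ∈ lowPart p (k - q.natDegree) := by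
  refine induction_on_roots (motive := fun q => (∀ z, q.IsRoot z → ‖z‖ ≤ 1) → ∀ k : ℤ,
    ratToMeas (algebraMap ℂ[X] (RatFunc ℂ) q) * x ∈ lowPart p k →
      x ∈ lowPart p (k - q.natDegree)) (fun c hc _ k h => ?_) (fun a q hq ih hroots k h => ?_)
      hq hroots k h
  · have := const_mul_mem_lowPart (c := c⁻¹) h
    rw [const_mul_cancel hc] at this
    simpa using this
  · rw [map_mul, map_mul, mul_assoc] at h
    have h1 := ih (fun z hz => hroots z (root_mul_left_of_isRoot _ hz)) _
      (mem_lowPart_of_linear_mul (hroots a (by simp)) (polynomial_mul_mem_Lp q hx) h)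
    rw [natDegree_mul (X_sub_C_ne_zero a) hq, natDegree_X_sub_C]
    convert h1 using 2
    push_cast
    ring

theorem mem_highPart_of_polynomial_mul {q : ℂ[X]} (hq : q ≠ 0)
    (hroots : ∀ z, q.IsRoot z → 1 ≤ ‖z‖)
    {x : MeasCircle} (hx : x ∈ Lp ℂ p (haarAddCircle : Measure UnitAddCircle)) {k : ℤ}
    (h : ratToMeas (algebraMap ℂ[X] (RatFunc ℂ) q) * x ∈ highPart p k) : x ∈ highPart p k := by
  refine induction_on_roots (motive := fun q => (∀ z, q.IsRoot z → 1 ≤ ‖z‖) →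
    ratToMeas (algebraMap ℂ[X] (RatFunc ℂ) q) * x ∈ highPart p k →
      x ∈ highPart p k) (fun c hc _ h => ?_) (fun a q hq ih hroots h => ?_) hq hroots h
  · have := const_mul_mem_highPart (c := c⁻¹) h
    rwa [const_mul_cancel hc] at this
  · rw [map_mul, map_mul, mul_assoc] at h
    exact ih (fun z hz => hroots z (root_mul_left_of_isRoot _ hz))
      (mem_highPart_of_linear_mul (hroots a (by simp)) (polynomial_mul_mem_Lp q hx) h)

/-- Reduces a rational multiplier to multiplication by its numerator followed by division by its
denominator, where the position of the poles decides what survives. -/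
theorem denom_mul_ratToMeas (r : RatFunc ℂ) (x : MeasCircle) :
    ratToMeas (algebraMap ℂ[X] (RatFunc ℂ) r.denom) * (ratToMeas r * x) =
      ratToMeas (algebraMap ℂ[X] (RatFunc ℂ) r.num) * x := by
  rw [← mul_assoc, ← map_mul]
  congr 2
  conv_lhs => rw [← RatFunc.num_div_denom r, RatFunc.num_div_denom r]
  nth_rewrite 2 [← RatFunc.num_div_denom r]
  exact mul_div_cancel₀ _ (RatFunc.algebraMap_ne_zero r.denom_ne_zero)

/-- Plus functions act on `z^k H^p`. -/
theorem mul_mem_highPart {r : RatFunc ℂ} (hr : r ∈ polesIn {z | 1 < ‖z‖}) {x : MeasCircle} {k : ℤ}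
    (hx : x ∈ highPart p k) : ratToMeas r * x ∈ highPart p k := by
  refine mem_highPart_of_polynomial_mul r.denom_ne_zero (fun z hz => (hr z hz).le)
    (ratToMeas_mul_mem_Lp (fun z hz => (hr z hz).ne') hx.1) ?_
  rw [denom_mul_ratToMeas]
  exact polynomial_mul_mem_highPart _ hx

/-- Minus functions act on `K^p`. -/
theorem mul_mem_lowPart {r : RatFunc ℂ} (hr : r ∈ properIn {z | ‖z‖ < 1}) {x : MeasCircle} {k : ℤ}
    (hx : x ∈ lowPart p k) : ratToMeas r * x ∈ lowPart p k := by
  have h := mem_lowPart_of_polynomial_mul (p := p) (k := k + r.num.natDegree) r.denom_ne_zero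
    (fun z hz => (hr.1 z hz).le) (ratToMeas_mul_mem_Lp (fun z hz => (hr.1 z hz).ne) hx.1) (by
      rw [denom_mul_ratToMeas]
      exact polynomial_mul_mem_lowPart _ hx)
  -- The numerator raises the bound by its degree and the denominator lowers it by its degree;
  -- properness makes the net change nonpositive.
  refine lowPart_mono ?_ h
  have := natDegree_le_natDegree hr.2
  omega

/-! ### Strictly proper rational functions in `K^p` and explicit splittings -/

theorem fourierCoeff_one_meas (n : ℤ) :
    fourierCoeff (1 : MeasCircle) n = if n = 0 then 1 else 0 := by
  have h : (1 : MeasCircle) =ᵐ[haarAddCircle] fun t : UnitAddCircle => (fourier 0 t : ℂ) := by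
    filter_upwards [AEEqFun.coeFn_one (α := UnitAddCircle) (β := ℂ) (μ := haarAddCircle)] with t ht
    rw [ht, fourier_zero]
    rfl
  rw [fourierCoeff_congr_ae h, fourierCoeff_fourier]
  simp [Pi.single_apply]

theorem one_mem_lowPart : (1 : MeasCircle) ∈ lowPart p 1 :=
  ⟨one_mem_Lp, fun n hn => by rw [fourierCoeff_one_meas, if_neg (by omega)]⟩

theorem one_mem_highPart : (1 : MeasCircle) ∈ highPart p 0 :=
  ⟨one_mem_Lp, fun n hn => by rw [fourierCoeff_one_meas, if_neg (by omega)]⟩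

/-- A strictly proper rational function in `L^p` with poles only in the closed disk is in
`K^p`. -/
theorem ratToMeas_mem_lowPart {r : RatFunc ℂ} (hr : r ∈ strictIn {z | ‖z‖ ≤ 1})
    (h : ratToMeas r ∈ Lp ℂ p (haarAddCircle : Measure UnitAddCircle)) :
    ratToMeas r ∈ lowPart p 0 := by
  by_cases h0 : r.num = 0
  · rw [RatFunc.num_eq_zero_iff.1 h0, map_zero]
    exact zero_mem _
  have h1 := mem_lowPart_of_polynomial_mul (p := p) (k := 1 + r.num.natDegree) r.denom_ne_zero
    hr.1 h (by
      have := denom_mul_ratToMeas r 1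
      rw [mul_one] at this
      rw [this]
      exact polynomial_mul_mem_lowPart _ one_mem_lowPart)
  -- The constant 1 has coefficient bound 1 rather than 0; strict properness supplies the missing
  -- unit.
  refine lowPart_mono ?_ h1
  have := natDegree_lt_natDegree h0 hr.2
  omega

theorem ratToMeas_mem_lowPart_of_disk {r : RatFunc ℂ} (hr : r ∈ strictIn {z | ‖z‖ < 1}) :
    ratToMeas r ∈ lowPart p 0 :=
  ratToMeas_mem_lowPart (strictIn_mono (fun z (hz : ‖z‖ < 1) => hz.le) hr)
    (ratToMeas_mem_Lp fun z hz => (hr.1 z hz).ne)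

/-- The recurrence `c_{n-1} = a c_n` for `n < 0` makes the negative coefficients geometric,
`c_{-1-j} = a^j c_{-1}`. These are the coefficients of `c_{-1} / (z - a)`, which is subtracted. -/
theorem exists_high_add_strict_of_linear_mul {a : ℂ} (ha : ‖a‖ < 1) {x : MeasCircle}
    (hx : x ∈ Lp ℂ p (haarAddCircle : Measure UnitAddCircle))
    (h : ratToMeas (algebraMap ℂ[X] (RatFunc ℂ) (X - C a)) * x ∈ highPart p 0) :
    ∃ y ∈ highPart p 0, ∃ w ∈ strictIn {z | ‖z‖ < 1}, x = y + ratToMeas w := by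
  have hne : algebraMap ℂ[X] (RatFunc ℂ) (X - C a) ≠ 0 :=
    RatFunc.algebraMap_ne_zero (X_sub_C_ne_zero a)
  set c := fourierCoeff x (-1) with hc
  set w := algebraMap ℂ[X] (RatFunc ℂ) (C c) / algebraMap ℂ[X] (RatFunc ℂ) (X - C a) with hw_def
  have hw : w ∈ strictIn {z | ‖z‖ < 1} :=
    div_mem_strictIn (X_sub_C_ne_zero a) (fun z hz => by rwa [← root_X_sub_C.1 hz]) (by
      rw [degree_X_sub_C]
      exact degree_C_le.trans_lt (by norm_num))
  have hwl : ratToMeas w ∈ lowPart p 0 := ratToMeas_mem_lowPart_of_disk hw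
  have hmul : ratToMeas (algebraMap ℂ[X] (RatFunc ℂ) (X - C a)) * ratToMeas w = c • 1 := by
    rw [← map_mul, hw_def, mul_div_cancel₀ _ hne, ← ratToMeas_C_mul, mul_one, RatFunc.algebraMap_C]
  have hwc : fourierCoeff (ratToMeas w) (-1) = c := by
    have h1 := fourierCoeff_linear_mul a hwl.1 0
    rw [hmul, fourierCoeff_smul_meas, fourierCoeff_one_meas, hwl.2 0 le_rfl] at h1
    simpa using h1.symm
  have hy : x - ratToMeas w ∈ Lp ℂ p (haarAddCircle : Measure UnitAddCircle) :=
    sub_mem hx hwl.1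
  have hy1 : ratToMeas (algebraMap ℂ[X] (RatFunc ℂ) (X - C a)) * (x - ratToMeas w) ∈
      highPart p 0 := by
    rw [mul_sub, hmul, ← ratToMeas_C_mul, ← RatFunc.algebraMap_C]
    exact sub_mem h (const_mul_mem_highPart one_mem_highPart)
  refine ⟨x - ratToMeas w, ⟨hy, ?_⟩, w, hw, (sub_add_cancel _ _).symm⟩
  have hy0 : ∀ j : ℕ, fourierCoeff (x - ratToMeas w : MeasCircle) (-1 - j) = 0 := by
    intro j
    induction j with
    | zero =>
      have h1 := fourierCoeff_add_meas hy hwl.1 (-1)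
      rw [sub_add_cancel, hwc, ← hc] at h1
      simpa using h1
    | succ j ih =>
      have h1 := hy1.2 (-1 - j) (by omega)
      rw [fourierCoeff_linear_mul a hy, ih, mul_zero, sub_zero] at h1
      rw [← h1]
      congr 1
      push_cast
      ring
  intro n hn
  have := hy0 (-1 - n).toNat
  rwa [show -1 - ((-1 - n).toNat : ℤ) = n by omega] at this

/-- A function in `L^p` with a polynomial multiple in `H^p` is in `H^p`, up to a strictly proper
rational function with poles in the open disk. -/
theorem exists_high_add_strict {q : ℂ[X]} (hq : q ≠ 0) {x : MeasCircle}
    (hx : x ∈ Lp ℂ p (haarAddCircle : Measure UnitAddCircle))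
    (h : ratToMeas (algebraMap ℂ[X] (RatFunc ℂ) q) * x ∈ highPart p 0) :
    ∃ y ∈ highPart p 0, ∃ w ∈ strictIn {z | ‖z‖ < 1}, x = y + ratToMeas w := by
  -- Roots outside the open disk are divided out within `H^p`. The others are removed one at a time,
  -- each contributing to the rational remainder.
  obtain ⟨q₁, q₂, rfl, h1, h2⟩ := exists_split {z | 1 ≤ ‖z‖} q hq
  rw [map_mul, map_mul, mul_assoc] at h
  have h3 := mem_highPart_of_polynomial_mul (left_ne_zero_of_mul hq) h1
    (polynomial_mul_mem_Lp q₂ hx) h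
  refine induction_on_roots (motive := fun q => (∀ z, q.IsRoot z → ‖z‖ < 1) →
    (∃ y ∈ highPart p 0, ∃ w ∈ strictIn {z | ‖z‖ < 1},
      ratToMeas (algebraMap ℂ[X] (RatFunc ℂ) q) * x = y + ratToMeas w) →
    ∃ y ∈ highPart p 0, ∃ w ∈ strictIn {z | ‖z‖ < 1}, x = y + ratToMeas w)
    ?_ ?_ (right_ne_zero_of_mul hq) (fun z hz => not_le.1 (h2 z hz))
    ⟨_, h3, 0, zero_mem _, by simp⟩
  · rintro c hc - ⟨y, hy, w, hw, hyw⟩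
    refine ⟨_, const_mul_mem_highPart (c := c⁻¹) hy, RatFunc.C c⁻¹ * w,
      mul_mem_strictIn (C_mem_properIn _ _) hw, ?_⟩
    rw [map_mul, ← RatFunc.algebraMap_C, ← mul_add, ← hyw, const_mul_cancel hc]
  · rintro a q hq ih hroots ⟨y, hy, w, hw, hyw⟩
    have ha : ‖a‖ < 1 := hroots a (by simp)
    have hne : algebraMap ℂ[X] (RatFunc ℂ) (X - C a) ≠ 0 :=
      RatFunc.algebraMap_ne_zero (X_sub_C_ne_zero a)
    -- From `(z - a) q x = y + w`, the function `q x - w / (z - a)` has the multiple `y` in `H^p`,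
    -- so the one-root case applies to it.
    have hw' : algebraMap ℂ[X] (RatFunc ℂ) 1 / algebraMap ℂ[X] (RatFunc ℂ) (X - C a) * w ∈
        strictIn {z | ‖z‖ < 1} :=
      mul_mem_strictIn (div_mem_properIn (X_sub_C_ne_zero a)
        (fun z hz => by rwa [← root_X_sub_C.1 hz]) (by simp)) hw
    obtain ⟨y', hy', w', hw'', hyw'⟩ := exists_high_add_strict_of_linear_mul (p := p) ha
      (x := ratToMeas (algebraMap ℂ[X] (RatFunc ℂ) q) * x - ratToMeas _)
      (sub_mem (polynomial_mul_mem_Lp q hx) (ratToMeas_mem_lowPart_of_disk hw').1) (by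
        rw [mul_sub, ← mul_assoc, ← map_mul, ← map_mul, hyw, ← map_mul, map_one, ← mul_assoc,
          mul_one_div_cancel hne, one_mul, add_sub_cancel_right]
        exact hy)
    refine ih (fun z hz => hroots z (root_mul_left_of_isRoot _ hz))
      ⟨y', hy', _, add_mem hw'' hw', ?_⟩
    rw [map_add, ← add_assoc, ← hyw', sub_add_cancel]

end RatToeplitz

end

noncomputable section

namespace RatToeplitz

open MeasureTheory AddCircle Polynomial

/-! ### The range of the Toeplitz-like operator -/

variable {p : ℝ≥0∞} [Fact (1 ≤ p)] {m : ℕ}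

theorem mem_hardy_iff {x : LpCircle p} : x ∈ hardy p ↔ (x : MeasCircle) ∈ highPart p 0 :=
  ⟨fun h => ⟨x.2, h⟩, fun h => h.2⟩

theorem mem_hardyMinus_iff {x : LpCircle p} :
    x ∈ hardyMinus p ↔ (x : MeasCircle) ∈ lowPart p 0 :=
  ⟨fun h => ⟨x.2, h⟩, fun h => h.2⟩

/-- An element of `H^p_m` as a vector of measurable functions. -/
def toMeasVec (f : HardyVec p m) (j : Fin m) : MeasCircle := ((f j : LpCircle p) : MeasCircle)

theorem toMeasVec_mem (f : HardyVec p m) (j : Fin m) : toMeasVec f j ∈ highPart p 0 :=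
  mem_hardy_iff.1 (f j).2

theorem exists_toMeasVec_eq {x : Fin m → MeasCircle} (hx : ∀ j, x j ∈ highPart p 0) :
    ∃ f : HardyVec p m, toMeasVec f = x :=
  ⟨fun j => ⟨⟨x j, (hx j).1⟩, mem_hardy_iff.2 (hx j)⟩, rfl⟩

theorem toMeasVec_injective : Function.Injective (toMeasVec : HardyVec p m → _) :=
  fun _ _ h => funext fun j => Subtype.ext (Subtype.ext (congrFun h j))

/-- The action of a rational matrix function on vectors of measurable functions. -/
def act (A : Matrix (Fin m) (Fin m) (RatFunc ℂ)) (x : Fin m → MeasCircle) : Fin m → MeasCircle :=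
  (A.map ratToMeas).mulVec x

theorem act_apply (A : Matrix (Fin m) (Fin m) (RatFunc ℂ)) (x : Fin m → MeasCircle) (i : Fin m) :
    act A x i = ∑ j, ratToMeas (A i j) * x j := rfl

theorem act_mul (A B : Matrix (Fin m) (Fin m) (RatFunc ℂ)) (x : Fin m → MeasCircle) :
    act (A * B) x = act A (act B x) := by
  rw [act, act, act, Matrix.mulVec_mulVec, Matrix.map_mul]

theorem act_one (x : Fin m → MeasCircle) : act 1 x = x := by
  rw [act, Matrix.map_one _ (map_zero _) (map_one _), Matrix.one_mulVec]

theorem act_add (A : Matrix (Fin m) (Fin m) (RatFunc ℂ)) (x y : Fin m → MeasCircle) :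
    act A (x + y) = act A x + act A y := Matrix.mulVec_add _ _ _

theorem act_sub (A : Matrix (Fin m) (Fin m) (RatFunc ℂ)) (x y : Fin m → MeasCircle) :
    act A (x - y) = act A x - act A y := Matrix.mulVec_sub _ _ _

theorem act_diagonal (d : Fin m → RatFunc ℂ) (x : Fin m → MeasCircle) (j : Fin m) :
    act (Matrix.diagonal d) x j = ratToMeas (d j) * x j := by
  rw [act, Matrix.diagonal_map (map_zero _), Matrix.mulVec_diagonal]

theorem act_ratToMeas (A : Matrix (Fin m) (Fin m) (RatFunc ℂ)) (w : Fin m → RatFunc ℂ) :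
    act A (fun j => ratToMeas (w j)) = fun i => ratToMeas (A.mulVec w i) := by
  funext i
  simp only [act_apply, Matrix.mulVec, dotProduct, map_sum, map_mul]

theorem act_mem_highPart {A : Matrix (Fin m) (Fin m) (RatFunc ℂ)}
    (hA : ∀ i j, A i j ∈ polesIn {z | 1 < ‖z‖}) {x : Fin m → MeasCircle}
    (hx : ∀ j, x j ∈ highPart p 0) (i : Fin m) : act A x i ∈ highPart p 0 := by
  rw [act_apply]
  exact sum_mem fun j _ => mul_mem_highPart (hA i j) (hx j)

theorem act_mem_lowPart {A : Matrix (Fin m) (Fin m) (RatFunc ℂ)}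
    (hA : ∀ i j, A i j ∈ properIn {z | ‖z‖ < 1}) {x : Fin m → MeasCircle}
    (hx : ∀ j, x j ∈ lowPart p 0) (i : Fin m) : act A x i ∈ lowPart p 0 := by
  rw [act_apply]
  exact sum_mem fun j _ => mul_mem_lowPart (hA i j) (hx j)

omit [Fact (1 ≤ p)] in
theorem act_mem_Lp {A : Matrix (Fin m) (Fin m) (RatFunc ℂ)}
    (hA : ∀ i j, A i j ∈ properIn {z | ‖z‖ < 1}) {x : Fin m → MeasCircle}
    (hx : ∀ j, x j ∈ Lp ℂ p (haarAddCircle : Measure UnitAddCircle)) (i : Fin m) :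
    act A x i ∈ Lp ℂ p (haarAddCircle : Measure UnitAddCircle) := by
  rw [act_apply]
  exact sum_mem fun j _ => ratToMeas_mul_mem_Lp (fun z hz => ((hA i j).1 z hz).ne) (hx j)

theorem mulVec_mem_strictIn {U : Set ℂ} {A : Matrix (Fin m) (Fin m) (RatFunc ℂ)}
    (hA : ∀ i j, A i j ∈ properIn U) {w : Fin m → RatFunc ℂ} (hw : ∀ j, w j ∈ strictIn U)
    (i : Fin m) : A.mulVec w i ∈ strictIn U := by
  rw [Matrix.mulVec, dotProduct]
  exact sum_mem fun j _ => mul_mem_strictIn (hA i j) (hw j)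

/-! ### The graph as an identity of measurable functions, and the value of the Riesz projection -/

theorem isDecomposition_iff {Ω : Matrix (Fin m) (Fin m) (RatFunc ℂ)} {f : HardyVec p m}
    {h : Fin m → LpCircle p} {η : Fin m → RatFunc ℂ} :
    IsDecomposition Ω f h η ↔ act Ω (toMeasVec f) =
      fun i => ((h i : LpCircle p) : MeasCircle) + ratToMeas (η i) := by
  rw [funext_iff]
  refine forall_congr' fun i => ?_
  rw [AEEqFun.ext_iff]
  have h1 : (act Ω (toMeasVec f) i : UnitAddCircle → ℂ) =ᵐ[haarAddCircle]
      fun t => ∑ j, onCircle (Ω i j) t * (f j : LpCircle p) t := by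
    have hm : ∀ᵐ t ∂(haarAddCircle : Measure UnitAddCircle), ∀ j,
        (ratToMeas (Ω i j) * toMeasVec f j : MeasCircle) t =
          onCircle (Ω i j) t * (f j : LpCircle p) t := ae_all_iff.2 fun j => by
      filter_upwards [AEEqFun.coeFn_mul (ratToMeas (Ω i j)) (toMeasVec f j),
        coeFn_ratToMeas (Ω i j)] with t h1 h2
      rw [h1, Pi.mul_apply, h2]
      rfl
    have hs : ∀ s : Finset (Fin m),
        ((∑ j ∈ s, ratToMeas (Ω i j) * toMeasVec f j : MeasCircle) : UnitAddCircle → ℂ)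
          =ᵐ[haarAddCircle] fun t => ∑ j ∈ s, onCircle (Ω i j) t * (f j : LpCircle p) t := by
      intro s
      induction s using Finset.induction_on with
      | empty =>
        simp only [Finset.sum_empty]
        exact AEEqFun.coeFn_zero
      | insert a s ha ih =>
        rw [Finset.sum_insert ha]
        filter_upwards [AEEqFun.coeFn_add (ratToMeas (Ω i a) * toMeasVec f a)
          (∑ j ∈ s, ratToMeas (Ω i j) * toMeasVec f j), ih, hm] with t h1 h2 h3
        rw [h1, Pi.add_apply, h2, h3 a, Finset.sum_insert ha]
    exact hs Finset.univ
  have h2 : (((h i : LpCircle p) : MeasCircle) + ratToMeas (η i) : MeasCircle)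
      =ᵐ[haarAddCircle] fun t => h i t + onCircle (η i) t := by
    filter_upwards [AEEqFun.coeFn_add (h i : MeasCircle) (ratToMeas (η i)),
      coeFn_ratToMeas (η i)] with t h1 h2
    rw [h1, Pi.add_apply, h2]
  exact ⟨fun h => Filter.EventuallyEq.trans h1 (Filter.EventuallyEq.trans h h2.symm),
    fun h => h1.symm.trans (h.trans h2)⟩

theorem mem_toeplitzGraph_iff {Ω : Matrix (Fin m) (Fin m) (RatFunc ℂ)} {f g : HardyVec p m} :
    (f, g) ∈ toeplitzGraph p Ω ↔ ∃ (h : Fin m → LpCircle p) (η : Fin m → RatFunc ℂ),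
      (∀ i, η i ∈ strictIn {z | ‖z‖ = 1}) ∧
      (act Ω (toMeasVec f) = fun i => ((h i : LpCircle p) : MeasCircle) + ratToMeas (η i)) ∧
      g = fun i => rieszProjection p (h i) := by
  simp only [← isDecomposition_iff]
  rfl

variable (p) in
/-- The measurable functions with a nonzero polynomial multiple in `H^p`. -/
def fractionHigh : AddSubgroup MeasCircle where
  carrier := {x | ∃ q : ℂ[X], q ≠ 0 ∧ ratToMeas (algebraMap ℂ[X] (RatFunc ℂ) q) * x ∈ highPart p 0}
  zero_mem' := ⟨1, one_ne_zero, by rw [mul_zero]; exact zero_mem _⟩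
  add_mem' := by
    rintro x y ⟨q, hq, hx⟩ ⟨q', hq', hy⟩
    refine ⟨q * q', mul_ne_zero hq hq', ?_⟩
    rw [mul_add]
    refine add_mem ?_ ?_
    · rw [mul_comm q, map_mul, map_mul, mul_assoc]
      exact polynomial_mul_mem_highPart _ hx
    · rw [map_mul, map_mul, mul_assoc]
      exact polynomial_mul_mem_highPart _ hy
  neg_mem' := by
    rintro x ⟨q, hq, hx⟩
    exact ⟨q, hq, by rw [mul_neg]; exact neg_mem hx⟩

theorem mul_mem_fractionHigh (r : RatFunc ℂ) {x : MeasCircle} (hx : x ∈ highPart p 0) :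
    ratToMeas r * x ∈ fractionHigh p :=
  ⟨r.denom, r.denom_ne_zero, by
    rw [denom_mul_ratToMeas]; exact polynomial_mul_mem_highPart _ hx⟩

theorem ratToMeas_mem_fractionHigh (r : RatFunc ℂ) : ratToMeas r ∈ fractionHigh p := by
  simpa using mul_mem_fractionHigh r (one_mem_highPart (p := p))

theorem act_mem_fractionHigh (A : Matrix (Fin m) (Fin m) (RatFunc ℂ)) {x : Fin m → MeasCircle}
    (hx : ∀ j, x j ∈ highPart p 0) (i : Fin m) : act A x i ∈ fractionHigh p := by
  rw [act_apply]
  exact sum_mem fun j _ => mul_mem_fractionHigh (A i j) (hx j)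

theorem rieszProjection_add_eq {x : LpCircle p} {y u : MeasCircle} (hy : y ∈ highPart p 0)
    (hu : u ∈ lowPart p 0) (h : (x : MeasCircle) = y + u) :
    ((rieszProjection p x : LpCircle p) : MeasCircle) = y := by
  have hx : x = (⟨y, hy.1⟩ : LpCircle p) + ⟨u, hu.1⟩ := Subtype.ext h
  have h1 := rieszProjection_coe (p := p) ⟨⟨y, hy.1⟩, mem_hardy_iff.2 hy⟩
  have h2 := rieszProjection_eq_zero (p := p) (u := ⟨u, hu.1⟩) (mem_hardyMinus_iff.2 hu)
  rw [hx, map_add, h2, add_zero]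
  exact congrArg (fun v : hardy p => ((v : LpCircle p) : MeasCircle)) h1

/-- `exists_high_add_strict` writes such an `x` explicitly as a sum from `H^p` and `K^p`, and the
two defining properties of the projection then give its value. -/
theorem sub_rieszProjection_mem {x : LpCircle p} (hx : (x : MeasCircle) ∈ fractionHigh p) :
    (x : MeasCircle) - ((rieszProjection p x : LpCircle p) : MeasCircle) ∈ lowPart p 0 := by
  obtain ⟨q, hq, hqx⟩ := hx
  obtain ⟨y, hy, w, hw, hyw⟩ := exists_high_add_strict hq x.2 hqx
  have hw' := ratToMeas_mem_lowPart_of_disk (p := p) hw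
  rw [rieszProjection_add_eq hy hw' hyw, hyw, add_sub_cancel_left]
  exact hw'

/-- If `f = 0`, then `h = -η` lies in `L^p` and is strictly proper with poles on the circle. So it
lies in `K^p` and is annihilated by the projection. -/
theorem toeplitzGraph_single_valued (Ω : Matrix (Fin m) (Fin m) (RatFunc ℂ)) :
    ∀ x ∈ toeplitzGraph p Ω, x.1 = 0 → x.2 = 0 := by
  rintro ⟨f, g⟩ hx (rfl : f = 0)
  obtain ⟨h, η, hη, hd, rfl⟩ := mem_toeplitzGraph_iff.1 hx
  funext i
  have hi : (h i : MeasCircle) = ratToMeas (-η i) := by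
    have h1 := congrFun hd i
    have h0 : toMeasVec (0 : HardyVec p m) = 0 := rfl
    rw [h0, act, Matrix.mulVec_zero] at h1
    rw [map_neg]
    exact eq_neg_of_add_eq_zero_left h1.symm
  refine rieszProjection_eq_zero (mem_hardyMinus_iff.2 ?_)
  rw [hi]
  exact ratToMeas_mem_lowPart
    (strictIn_mono (fun z (hz : ‖z‖ = 1) => hz.le) (neg_mem (hη i))) (hi ▸ (h i).2)

theorem X_zpow_mem_polesIn (s : ℤ) : (RatFunc.X : RatFunc ℂ) ^ s ∈ polesIn {0} := by
  obtain ⟨n, rfl | rfl⟩ := s.eq_nat_or_neg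
  · rw [zpow_natCast, ← RatFunc.algebraMap_X, ← map_pow]
    exact algebraMap_mem_polesIn _ _
  · have hf : IsFraction {0} ((RatFunc.X : RatFunc ℂ) ^ (-(n : ℤ))) 1 (X ^ n) :=
      ⟨pow_ne_zero n X_ne_zero, fun z hz => by
        rw [IsRoot.def, eval_pow, eval_X] at hz
        exact eq_zero_of_pow_eq_zero hz, by simp⟩
    exact hf.poles

omit [Fact (1 ≤ p)] in
theorem X_zpow_mul_mem_Lp (s : ℤ) {x : MeasCircle}
    (hx : x ∈ Lp ℂ p (haarAddCircle : Measure UnitAddCircle)) :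
    ratToMeas (RatFunc.X ^ s) * x ∈ Lp ℂ p (haarAddCircle : Measure UnitAddCircle) :=
  ratToMeas_mul_mem_Lp (fun z hz => by
    have : z = 0 := X_zpow_mem_polesIn s z hz
    simp [this]) hx

/-- A factorization `B diag (z^{s_j}) W` with `W^{±1}` plus functions, `B⁻¹` a minus function and
`B` proper with poles in the closed disk. -/
structure DiagonalFactorization (s : Fin m → ℤ) (B C W V : Matrix (Fin m) (Fin m) (RatFunc ℂ)) :
    Prop where
  left_inv : C * B = 1
  right_inv : B * C = 1
  plus_inv : W * V = 1
  left_mem : ∀ i j, B i j ∈ properIn {z | ‖z‖ ≤ 1}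
  inv_mem : ∀ i j, C i j ∈ properIn {z | ‖z‖ < 1}
  plus_mem : ∀ i j, W i j ∈ polesIn {z | 1 < ‖z‖}
  plus_inv_mem : ∀ i j, V i j ∈ polesIn {z | 1 < ‖z‖}

/-- The diagonal matrix function `diag (z^{s_j})`. -/
def zpowDiagonal (s : Fin m → ℤ) : Matrix (Fin m) (Fin m) (RatFunc ℂ) :=
  Matrix.diagonal fun j => (RatFunc.X : RatFunc ℂ) ^ s j

namespace DiagonalFactorization

variable {s : Fin m → ℤ} {B C W V : Matrix (Fin m) (Fin m) (RatFunc ℂ)}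

theorem inv_mem_closed (H : DiagonalFactorization s B C W V) (i j : Fin m) :
    C i j ∈ properIn {z | ‖z‖ ≤ 1} :=
  properIn_mono (fun z (hz : ‖z‖ < 1) => hz.le) (H.inv_mem i j)

/-- Applying `C` to `Ω f = g + u + η`, with `u` in `K^p`, gives `z^{s_j} (W f)_j = (C g)_j + (C u)_j
+ (C η)_j`. The left side has no coefficients below `s_j`, and the last two terms have none from 0
on. -/
theorem fourierCoeff_eq_zero (H : DiagonalFactorization s B C W V) {f g : HardyVec p m}
    (hfg : (f, g) ∈ toeplitzGraph p (B * zpowDiagonal s * W)) (j : Fin m) (n : ℤ) (hn : 0 ≤ n)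
    (hns : n < s j) : fourierCoeff (act C (toMeasVec g) j) n = 0 := by
  obtain ⟨h, η, hη, hd, hg⟩ := mem_toeplitzGraph_iff.1 hfg
  have hh : ∀ i, (h i : MeasCircle) ∈ fractionHigh p := fun i => by
    rw [eq_sub_of_add_eq (congrFun hd i).symm]
    exact sub_mem (act_mem_fractionHigh _ (toMeasVec_mem f) i) (ratToMeas_mem_fractionHigh _)
  set u : Fin m → MeasCircle := fun i => (h i : MeasCircle) - toMeasVec g i with hu_def
  have hu : ∀ i, u i ∈ lowPart p 0 := fun i => by
    have := sub_rieszProjection_mem (hh i)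
    rw [hu_def, hg]
    exact this
  have hd' : act (B * zpowDiagonal s * W) (toMeasVec f) =
      toMeasVec g + u + fun i => ratToMeas (η i) := by
    rw [hd]
    funext i
    simp only [Pi.add_apply, hu_def, add_sub_cancel]
  have key := congrArg (act C) hd'
  rw [← act_mul, Matrix.mul_assoc, ← Matrix.mul_assoc C, H.left_inv, Matrix.one_mul, act_mul,
    act_add, act_add, act_ratToMeas] at key
  have hj := congrFun key j
  simp only [zpowDiagonal, act_diagonal, Pi.add_apply] at hj
  have hW := act_mem_highPart H.plus_mem (toMeasVec_mem f) j
  have hL := X_zpow_mul_mem_Lp (s j) hW.1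
  have hg' := act_mem_Lp H.inv_mem (fun i => (toMeasVec_mem g i).1) j
  have hu' := act_mem_lowPart H.inv_mem hu j
  -- `C η` may have formal poles on the circle; the identity `hj` shows that it is nevertheless in
  -- `L^p`.
  have hη' : ratToMeas (C.mulVec η j) ∈ lowPart p 0 :=
    ratToMeas_mem_lowPart (mulVec_mem_strictIn H.inv_mem_closed
      (fun i => strictIn_mono (fun z (hz : ‖z‖ = 1) => hz.le) (hη i)) j) (by
        rw [eq_sub_of_add_eq' hj.symm]
        exact sub_mem hL (add_mem hg' hu'.1))
  have hc := fourierCoeff_X_zpow_mul (s j) (act W (toMeasVec f) j) n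
  rw [hW.2 _ (by omega), hj, fourierCoeff_add_meas (add_mem hg' hu'.1) hη'.1,
    fourierCoeff_add_meas hg' hu'.1, hu'.2 n hn, hη'.2 n hn, add_zero, add_zero] at hc
  exact hc

/-- Split `C g = y + w` with `y` in `H^p` and `w` strictly proper. The vanishing coefficients allow
division of `y_j` by `z^{s_j}` within `H^p`, and `f = V diag(z^{-s_j}) y` satisfies `Ω f = g - B w`.
The part of `B w` with poles in the open disk is in `K^p` and goes into `h`; the part with poles on
the circle is `-η`. -/
theorem exists_mem_graph (H : DiagonalFactorization s B C W V) {g : HardyVec p m}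
    (hg : ∀ j n, 0 ≤ n → n < s j → fourierCoeff (act C (toMeasVec g) j) n = 0) :
    ∃ f, (f, g) ∈ toeplitzGraph p (B * zpowDiagonal s * W) := by
  have h1 : ∀ j, ∃ y ∈ highPart p 0, ∃ w ∈ strictIn {z | ‖z‖ < 1},
      act C (toMeasVec g) j = y + ratToMeas w := fun j => by
    obtain ⟨q, hq, hx⟩ := act_mem_fractionHigh C (toMeasVec_mem g) j
    exact exists_high_add_strict hq (act_mem_Lp H.inv_mem (fun i => (toMeasVec_mem g i).1) j) hx
  choose y hy w hw hyw using h1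
  have hF : ∀ j, ratToMeas (RatFunc.X ^ (-s j)) * y j ∈ highPart p 0 := fun j => by
    refine ⟨X_zpow_mul_mem_Lp _ (hy j).1, fun n hn => ?_⟩
    rw [fourierCoeff_X_zpow_mul, sub_neg_eq_add]
    rcases lt_or_ge (n + s j) 0 with h0 | h0
    · exact (hy j).2 _ h0
    · have hwl := ratToMeas_mem_lowPart_of_disk (p := p) (hw j)
      have := hg j (n + s j) h0 (by omega)
      rwa [hyw, fourierCoeff_add_meas (hy j).1 hwl.1, hwl.2 _ h0, add_zero] at this
  obtain ⟨f, hf⟩ := exists_toMeasVec_eq (fun i => act_mem_highPart H.plus_inv_mem hF i)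
  have hΩ : act (B * zpowDiagonal s * W) (toMeasVec f) = toMeasVec g -
      fun i => ratToMeas (B.mulVec w i) := by
    have hfW : act W (toMeasVec f) = fun j => ratToMeas (RatFunc.X ^ (-s j)) * y j := by
      rw [hf]
      rw [← act_mul, H.plus_inv, act_one]
    have hD : act (zpowDiagonal s) (act W (toMeasVec f)) = y := by
      funext j
      rw [zpowDiagonal, act_diagonal, hfW, ← mul_assoc, ← map_mul, zpow_neg,
        mul_inv_cancel₀ (zpow_ne_zero _ RatFunc.X_ne_zero), map_one, one_mul]
    have hy' : y = act C (toMeasVec g) - fun j => ratToMeas (w j) := by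
      funext j
      rw [Pi.sub_apply, hyw, add_sub_cancel_right]
    rw [act_mul, act_mul, hD, hy', act_sub, ← act_mul, H.right_inv, act_one, act_ratToMeas]
  have hBw : ∀ i, B.mulVec w i ∈ strictIn {z | ‖z‖ ≤ 1} := fun i =>
    mulVec_mem_strictIn H.left_mem
      (fun i => strictIn_mono (fun z (hz : ‖z‖ < 1) => hz.le) (hw i)) i
  choose v hv η hη hvη using fun i => exists_add_of_mem_strictIn {z : ℂ | ‖z‖ < 1} (hBw i)
  have hvl : ∀ i, ratToMeas (v i) ∈ lowPart p 0 := fun i =>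
    ratToMeas_mem_lowPart_of_disk (strictIn_mono Set.inter_subset_right (hv i))
  have hh : ∀ i, toMeasVec g i - ratToMeas (v i) ∈
      Lp ℂ p (haarAddCircle : Measure UnitAddCircle) := fun i =>
    sub_mem (toMeasVec_mem g i).1 (hvl i).1
  refine ⟨f, mem_toeplitzGraph_iff.2 ⟨fun i => ⟨_, hh i⟩, fun i => -η i, fun i => neg_mem
    (strictIn_mono (fun z hz => le_antisymm hz.1 (not_lt.1 hz.2)) (hη i)), ?_, ?_⟩⟩
  · rw [hΩ]
    funext i
    rw [Pi.sub_apply, hvη, map_add, map_neg]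
    ring
  · refine toMeasVec_injective (funext fun i => ?_)
    exact (rieszProjection_add_eq (toMeasVec_mem g i) (neg_mem (hvl i)) (sub_eq_add_neg _ _)).symm

end DiagonalFactorization

/-! ### The coefficient functionals and the codimension of the range -/

theorem toMeasVec_smul (c : ℂ) (g : HardyVec p m) :
    toMeasVec (c • g) = fun j => ratToMeas (RatFunc.C c) * toMeasVec g j := by
  funext j
  rw [ratToMeas_C_mul]
  rfl

theorem act_const_mul (A : Matrix (Fin m) (Fin m) (RatFunc ℂ)) (r : MeasCircle)
    (x : Fin m → MeasCircle) (i : Fin m) : act A (fun j => r * x j) i = r * act A x i := by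
  simp only [act_apply, Finset.mul_sum]
  exact Finset.sum_congr rfl fun j _ => by ring

/-- The Fourier coefficients of the components of `C g` with index in `[0, s_j)`. -/
def coeffMap (s : Fin m → ℤ) {C : Matrix (Fin m) (Fin m) (RatFunc ℂ)}
    (hC : ∀ i j, C i j ∈ properIn {z | ‖z‖ < 1}) :
    HardyVec p m →ₗ[ℂ] ((j : Fin m) → Fin (s j).toNat → ℂ) where
  toFun g j i := fourierCoeff (act C (toMeasVec g) j) (i : ℕ)
  map_add' g g' := by
    funext j i
    have h : toMeasVec (g + g') = toMeasVec g + toMeasVec g' := rfl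
    rw [h, act_add]
    exact fourierCoeff_add_meas (act_mem_Lp hC (fun i => (toMeasVec_mem g i).1) j)
      (act_mem_Lp hC (fun i => (toMeasVec_mem g' i).1) j) _
  map_smul' c g := by
    funext j i
    rw [toMeasVec_smul, act_const_mul, ratToMeas_C_mul, fourierCoeff_smul_meas]
    rfl

theorem fourierCoeff_polynomial (q : ℂ[X]) (n : ℕ) :
    fourierCoeff (ratToMeas (algebraMap ℂ[X] (RatFunc ℂ) q) : MeasCircle) n = q.coeff n := by
  induction q using Polynomial.induction_on' with
  | add q q' h h' =>
    rw [map_add, map_add, fourierCoeff_add_meas (p := 1)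
      (ratToMeas_mem_Lp (algebraMap_mem_polesIn _ _))
      (ratToMeas_mem_Lp (algebraMap_mem_polesIn _ _)), h, h', coeff_add]
  | monomial k c =>
    have h : ratToMeas (algebraMap ℂ[X] (RatFunc ℂ) (monomial k c)) =
        c • (ratToMeas (RatFunc.X ^ (k : ℤ)) * 1) := by
      rw [RatFunc.algebraMap_monomial, map_mul, ratToMeas_C_mul, mul_one, zpow_natCast]
    rw [h, fourierCoeff_smul_meas, fourierCoeff_X_zpow_mul, fourierCoeff_one_meas,
      coeff_monomial]
    by_cases hk : k = n
    · simp [hk]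
    · rw [if_neg hk, if_neg (by omega), mul_zero]

theorem polynomial_mem_highPart (q : ℂ[X]) :
    ratToMeas (algebraMap ℂ[X] (RatFunc ℂ) q) ∈ highPart p 0 := by
  simpa using polynomial_mul_mem_highPart q (one_mem_highPart (p := p))

namespace DiagonalFactorization

variable {s : Fin m → ℤ} {B C W V : Matrix (Fin m) (Fin m) (RatFunc ℂ)}

/-- Let `τ` be the polynomial vector with the prescribed coefficients. Since `B τ` may have poles in
the closed disk, only its polynomial part `γ` is used. Then `C γ = τ - C w` with `w` strictly
proper, and `C w` is in `K^p`, so it does not affect the coefficients of index `≥ 0`. -/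
theorem coeffMap_surjective (H : DiagonalFactorization s B C W V) :
    Function.Surjective (coeffMap (p := p) s H.inv_mem) := by
  intro t
  set τ : Fin m → RatFunc ℂ := fun j => algebraMap ℂ[X] (RatFunc ℂ) (ofFn (s j).toNat (t j))
  have hτ : ∀ i, B.mulVec τ i ∈ polesIn {z | ‖z‖ ≤ 1} := fun i => by
    rw [Matrix.mulVec, dotProduct]
    exact sum_mem fun j _ => (polesIn _).mul_mem (H.left_mem i j).1 (algebraMap_mem_polesIn _ _)
  choose γ w hw hγ using fun i => exists_polynomial_add_strict (hτ i)
  obtain ⟨g, hg⟩ := exists_toMeasVec_eq fun i => polynomial_mem_highPart (p := p) (γ i)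
  refine ⟨g, funext fun j => funext fun i => ?_⟩
  have key : act C (toMeasVec g) = (fun j => ratToMeas (τ j)) -
      fun j => ratToMeas (C.mulVec w j) := by
    have : toMeasVec g = act B (fun j => ratToMeas (τ j)) - fun j => ratToMeas (w j) := by
      rw [hg, act_ratToMeas]
      funext i
      rw [Pi.sub_apply, hγ, map_add, add_sub_cancel_right]
    rw [this, act_sub, ← act_mul, H.left_inv, act_one, act_ratToMeas]
  have hj := congrFun key j
  rw [Pi.sub_apply] at hj
  have hgL := act_mem_Lp H.inv_mem (fun i => (toMeasVec_mem g i).1) j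
  have hτL : ratToMeas (τ j) ∈ highPart p 0 := polynomial_mem_highPart _
  have hwl : ratToMeas (C.mulVec w j) ∈ lowPart p 0 :=
    ratToMeas_mem_lowPart (mulVec_mem_strictIn H.inv_mem_closed hw j) (by
      rw [← sub_sub_cancel (ratToMeas (τ j)) (ratToMeas (C.mulVec w j)), ← hj]
      exact sub_mem hτL.1 hgL)
  have h1 := fourierCoeff_add_meas hgL hwl.1 (i : ℕ)
  rw [hwl.2 _ (by omega), add_zero, eq_sub_iff_add_eq.1 hj, fourierCoeff_polynomial,
    ofFn_coeff_eq_val_of_lt _ i.2] at h1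
  exact h1.symm

theorem range_eq_ker (H : DiagonalFactorization s B C W V) :
    LinearMap.range (toeplitz p (B * zpowDiagonal s * W)).toFun =
      LinearMap.ker (coeffMap (p := p) s H.inv_mem) := by
  rw [toeplitz, Submodule.toLinearPMap_range _ (toeplitzGraph_single_valued _)]
  ext g
  rw [LinearMap.mem_ker]
  constructor
  · rintro ⟨⟨f, g⟩, hfg, rfl⟩
    funext j i
    exact H.fourierCoeff_eq_zero hfg j (i : ℕ) (by omega) (by have := i.2; omega)
  · intro hg
    obtain ⟨f, hf⟩ := H.exists_mem_graph (g := g) fun j n h0 hn => by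
      have := congrFun (congrFun hg j) ⟨n.toNat, by omega⟩
      rw [← Int.toNat_of_nonneg h0]
      exact this
    exact ⟨(f, g), hf, rfl⟩

/-- The quotient by the range of `T_Ω`. -/
def quotientRangeEquiv (H : DiagonalFactorization s B C W V) :
    (HardyVec p m ⧸ LinearMap.range (toeplitz p (B * zpowDiagonal s * W)).toFun) ≃ₗ[ℂ]
      ((j : Fin m) → Fin (s j).toNat → ℂ) :=
  (Submodule.quotEquivOfEq _ _ H.range_eq_ker).trans
    (LinearMap.quotKerEquivOfSurjective _ H.coeffMap_surjective)

theorem finiteDimensional (H : DiagonalFactorization s B C W V) :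
    FiniteDimensional ℂ
      (HardyVec p m ⧸ LinearMap.range (toeplitz p (B * zpowDiagonal s * W)).toFun) :=
  (H.quotientRangeEquiv (p := p)).symm.finiteDimensional

theorem codimRange_eq (H : DiagonalFactorization s B C W V) :
    codimRange (toeplitz p (B * zpowDiagonal s * W)) = ∑ j, (s j).toNat := by
  rw [codimRange, (H.quotientRangeEquiv (p := p)).finrank_eq, Module.finrank_pi_fintype]
  simp

end DiagonalFactorization

end RatToeplitz

end

noncomputable section

namespace RatToeplitz

open MeasureTheory AddCircle Polynomial

/-! ### From a factorization in special form to a diagonal factorization -/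

section Matrices

variable {m : ℕ}

/-- The inverse is the adjugate, which can be computed over `S`. -/
theorem exists_inverse_of_det_eq_one {S : Subring (RatFunc ℂ)}
    {A : Matrix (Fin m) (Fin m) (RatFunc ℂ)} (hA : ∀ i j, A i j ∈ S) (hdet : A.det = 1) :
    ∃ A' : Matrix (Fin m) (Fin m) (RatFunc ℂ), (∀ i j, A' i j ∈ S) ∧ A * A' = 1 := by
  set A₀ : Matrix (Fin m) (Fin m) S := fun i j => ⟨A i j, hA i j⟩
  have hmap : A₀.map S.subtype = A := rfl
  have hadj : A₀.adjugate.map S.subtype = A.adjugate := by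
    rw [← hmap]
    exact RingHom.map_adjugate S.subtype A₀
  refine ⟨A.adjugate, fun i j => ?_, ?_⟩
  · rw [← hadj]
    exact (A₀.adjugate i j).2
  · rw [Matrix.mul_adjugate, hdet, one_smul]

theorem mul_mem_subring {S : Subring (RatFunc ℂ)} {A B : Matrix (Fin m) (Fin m) (RatFunc ℂ)}
    (hA : ∀ i j, A i j ∈ S) (hB : ∀ i j, B i j ∈ S) (i j : Fin m) : (A * B) i j ∈ S := by
  rw [Matrix.mul_apply]
  exact sum_mem fun k _ => mul_mem (hA i k) (hB k j)

theorem diagonal_mem_subring {S : Subring (RatFunc ℂ)} {d : Fin m → RatFunc ℂ}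
    (hd : ∀ i, d i ∈ S) (i j : Fin m) : Matrix.diagonal d i j ∈ S := by
  rw [Matrix.diagonal_apply]
  split_ifs
  exacts [hd i, zero_mem _]

end Matrices

theorem polynomial_mul_zpow_mem_properIn {N : ℂ[X]} {l : ℤ}
    (h : N ≠ 0 → (N.natDegree : ℤ) ≤ l) :
    algebraMap ℂ[X] (RatFunc ℂ) N * RatFunc.X ^ (-l) ∈ properIn {z | ‖z‖ < 1} := by
  by_cases hN : N = 0
  · simp [hN, zero_mem]
  have hl := h hN
  -- For `N ≠ 0` the degree bound forces `l ≥ 0`, so the only possible pole is 0.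
  obtain ⟨n, rfl⟩ := Int.eq_ofNat_of_zero_le ((Int.natCast_nonneg _).trans hl)
  have : algebraMap ℂ[X] (RatFunc ℂ) N * RatFunc.X ^ (-(n : ℤ)) =
      algebraMap ℂ[X] (RatFunc ℂ) N / algebraMap ℂ[X] (RatFunc ℂ) (X ^ n) := by
    rw [zpow_neg, zpow_natCast, map_pow, RatFunc.algebraMap_X, div_eq_mul_inv]
  rw [this]
  refine div_mem_properIn (pow_ne_zero n X_ne_zero) (fun z hz => ?_) ?_
  · rw [IsRoot.def, eval_pow, eval_X] at hz
    simp [eq_zero_of_pow_eq_zero hz]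
  · rw [degree_X_pow]
    exact degree_le_of_natDegree_le (by exact_mod_cast hl)

namespace MiddleForm

variable {m : ℕ} {Ω : Matrix (Fin m) (Fin m) (RatFunc ℂ)} {F : WienerHopfFactorization Ω}

/-- The unipotent matrix function with the entries `p_{ij} z^{-(k_j - deg q_j + deg q_i)}`. -/
def unipotent (M : MiddleForm F) : Matrix (Fin m) (Fin m) (RatFunc ℂ) := fun i j =>
  algebraMap ℂ[X] (RatFunc ℂ) (M.p i j) *
    RatFunc.X ^ (-((M.e j : ℤ) - (M.q j).natDegree + (M.q i).natDegree))

/-- The functions `z^{deg q_i} / q_i`. -/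
def unitQuotient (M : MiddleForm F) (i : Fin m) : RatFunc ℂ :=
  algebraMap ℂ[X] (RatFunc ℂ) (X ^ (M.q i).natDegree) / algebraMap ℂ[X] (RatFunc ℂ) (M.q i)

/-- The special form enters here: below the diagonal it bounds the degree of `p_{ij}` by the power
of `z` by which the entry is divided. -/
theorem unipotent_mem (M : MiddleForm F) (hM : M.IsSpecial) (i j : Fin m) :
    M.unipotent i j ∈ properIn {z | ‖z‖ < 1} := by
  refine polynomial_mul_zpow_mem_properIn fun h => ?_
  rcases lt_trichotomy i j with hij | rfl | hij
  · exact absurd (M.p_lower i j hij) h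
  · rw [M.p_diag, natDegree_X_pow]
    omega
  · have := hM j i hij h
    omega

theorem det_unipotent (M : MiddleForm F) : M.unipotent.det = 1 := by
  rw [Matrix.det_of_isLowerTriangular]
  · refine Finset.prod_eq_one fun i _ => ?_
    rw [unipotent, M.p_diag, map_pow, RatFunc.algebraMap_X, sub_add_cancel, zpow_neg, zpow_natCast,
      mul_inv_cancel₀ (pow_ne_zero _ RatFunc.X_ne_zero)]
  · intro i j hij
    rw [unipotent, M.p_lower i j hij, map_zero, zero_mul]

theorem degree_X_pow_eq (M : MiddleForm F) (i : Fin m) :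
    (X ^ (M.q i).natDegree : ℂ[X]).degree = (M.q i).degree := by
  rw [degree_X_pow, degree_eq_natDegree (M.q_ne_zero i)]

theorem unitQuotient_mem (M : MiddleForm F) (i : Fin m) :
    M.unitQuotient i ∈ properIn {z | ‖z‖ ≤ 1} :=
  div_mem_properIn (M.q_ne_zero i) (fun z hz => (M.q_roots i z hz).le) (M.degree_X_pow_eq i).le

/-- The zeroes of `q_i` on the circle become poles of `B` only; the inverse `q_i / z^{deg q_i}` has
no pole except possibly 0. This keeps `C` a minus function. -/
theorem unitQuotient_inv_mem (M : MiddleForm F) (i : Fin m) :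
    (M.unitQuotient i)⁻¹ ∈ properIn {z | ‖z‖ < 1} := by
  rw [unitQuotient, inv_div]
  refine div_mem_properIn (pow_ne_zero _ X_ne_zero) (fun z hz => ?_) (M.degree_X_pow_eq i).ge
  rw [IsRoot.def, eval_pow, eval_X] at hz
  simp [eq_zero_of_pow_eq_zero hz]

theorem unitQuotient_ne_zero (M : MiddleForm F) (i : Fin m) : M.unitQuotient i ≠ 0 :=
  div_ne_zero (RatFunc.algebraMap_ne_zero (pow_ne_zero _ X_ne_zero))
    (RatFunc.algebraMap_ne_zero (M.q_ne_zero i))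

theorem middle_eq (M : MiddleForm F) :
    F.middle = Matrix.diagonal M.unitQuotient * M.unipotent * zpowDiagonal M.index := by
  have hX : (RatFunc.X : RatFunc ℂ) ≠ 0 := RatFunc.X_ne_zero
  ext i j
  rw [zpowDiagonal, Matrix.mul_diagonal, Matrix.diagonal_mul, M.eq, unitQuotient, unipotent, index]
  have h : (RatFunc.X : RatFunc ℂ) ^ (-(F.k : ℤ)) = RatFunc.X ^ ((M.q i).natDegree : ℤ) *
      RatFunc.X ^ (-((M.e j : ℤ) - (M.q j).natDegree + (M.q i).natDegree)) *
      RatFunc.X ^ ((M.e j : ℤ) - (M.q j).natDegree - F.k) := by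
    rw [← zpow_add₀ hX, ← zpow_add₀ hX]
    congr 1
    ring
  rw [h, map_pow, RatFunc.algebraMap_X, zpow_natCast]
  ring

/-- The scalar factor `z^n` is absorbed by the diagonal, so one `B` and one `W` serve every shift.
-/
theorem exists_diagonalFactorization (M : MiddleForm F) (hM : M.IsSpecial) (n : ℤ) :
    ∃ B C W V, DiagonalFactorization (fun j => M.index j + n) B C W V ∧
      shift n Ω = B * zpowDiagonal (fun j => M.index j + n) * W := by
  obtain ⟨A', hA', h1⟩ := exists_inverse_of_det_eq_one (M.unipotent_mem hM) M.det_unipotent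
  have hm := (Matrix.isUnit_iff_isUnit_det _).1 F.isUnit_minus
  have hp := (Matrix.isUnit_iff_isUnit_det _).1 F.isUnit_plus
  have hle : ∀ r : RatFunc ℂ, r ∈ properIn {z | ‖z‖ < 1} → r ∈ properIn {z | ‖z‖ ≤ 1} :=
    fun r => properIn_mono fun z (hz : ‖z‖ < 1) => hz.le
  have hd : Matrix.diagonal M.unitQuotient *
      Matrix.diagonal (fun i => (M.unitQuotient i)⁻¹) = 1 := by
    simp [Matrix.diagonal_mul_diagonal, M.unitQuotient_ne_zero]
  have hright : (F.Ωminus * (Matrix.diagonal M.unitQuotient * M.unipotent)) *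
      (A' * Matrix.diagonal (fun i => (M.unitQuotient i)⁻¹) * F.Ωminus⁻¹) = 1 := by
    calc _ = F.Ωminus * (Matrix.diagonal M.unitQuotient * (M.unipotent * A') *
          Matrix.diagonal (fun i => (M.unitQuotient i)⁻¹)) * F.Ωminus⁻¹ := by
            simp only [Matrix.mul_assoc]
      _ = 1 := by rw [h1, Matrix.mul_one, hd, Matrix.mul_one, Matrix.mul_nonsing_inv _ hm]
  refine ⟨F.Ωminus * (Matrix.diagonal M.unitQuotient * M.unipotent),
    A' * Matrix.diagonal (fun i => (M.unitQuotient i)⁻¹) * F.Ωminus⁻¹, F.Ωplus, F.Ωplus⁻¹,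
    ⟨mul_eq_one_comm.1 hright, hright, Matrix.mul_nonsing_inv _ hp, ?_, ?_, F.plus,
      F.plus_inv⟩, ?_⟩
  · exact mul_mem_subring (fun i j => hle _ (F.minus i j))
      (mul_mem_subring (diagonal_mem_subring M.unitQuotient_mem)
        fun i j => hle _ (M.unipotent_mem hM i j))
  · exact mul_mem_subring (mul_mem_subring hA' (diagonal_mem_subring M.unitQuotient_inv_mem))
      F.minus_inv
  · have hΩ : Ω = F.Ωminus * F.middle * F.Ωplus := by
      rw [WienerHopfFactorization.middle, Matrix.mul_smul, Matrix.smul_mul, ← Matrix.mul_assoc]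
      exact F.eq
    have hz : zpowDiagonal (fun j => M.index j + n) =
        (RatFunc.X : RatFunc ℂ) ^ n • zpowDiagonal M.index := by
      rw [zpowDiagonal, zpowDiagonal, ← Matrix.diagonal_smul]
      congr 1
      funext j
      rw [zpow_add₀ RatFunc.X_ne_zero, Pi.smul_apply, smul_eq_mul, mul_comm]
    rw [shift, hz, Matrix.mul_smul, Matrix.smul_mul]
    congr 1
    conv_lhs => rw [hΩ, M.middle_eq]
    simp only [Matrix.mul_assoc]

variable {p : ℝ≥0∞} [Fact (1 ≤ p)]

theorem finiteDimensional_quotient_range (M : MiddleForm F) (hM : M.IsSpecial) (n : ℤ) :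
    FiniteDimensional ℂ (HardyVec p m ⧸ LinearMap.range (toeplitz p (shift n Ω)).toFun) := by
  obtain ⟨B, C, W, V, H, h⟩ := M.exists_diagonalFactorization hM n
  rw [h]
  exact H.finiteDimensional

theorem codimRange_shift (M : MiddleForm F) (hM : M.IsSpecial) (n : ℤ) :
    codimRange (toeplitz p (shift n Ω)) = ∑ j, (M.index j + n).toNat := by
  obtain ⟨B, C, W, V, H, h⟩ := M.exists_diagonalFactorization hM n
  rw [h]
  exact H.codimRange_eq

variable (p) in
-- The second difference of `n ↦ max(κ_j + n, 0)` at `n = -κ` is 1 if `κ_j = κ` and 0 otherwise.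
theorem card_index_eq (M : MiddleForm F) (hM : M.IsSpecial) (κ : ℤ) :
    ((Finset.univ.filter fun j => M.index j = κ).card : ℤ) =
      (codimRange (toeplitz p (shift (1 - κ) Ω)) : ℤ)
        - 2 * codimRange (toeplitz p (shift (-κ) Ω))
        + codimRange (toeplitz p (shift (-κ - 1) Ω)) := by
  rw [M.codimRange_shift hM, M.codimRange_shift hM, M.codimRange_shift hM, Finset.card_filter]
  push_cast
  rw [Finset.mul_sum, ← Finset.sum_sub_distrib, ← Finset.sum_add_distrib]
  refine Finset.sum_congr rfl fun j _ => ?_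
  split_ifs <;> omega

end MiddleForm

/-! ### The operator determines the symbol -/

/-- Makes `ratToMeas`, a ring homomorphism from a field, injective. -/
instance : Nontrivial MeasCircle := by
  refine ⟨⟨1, 0, fun h => ?_⟩⟩
  have h1 := fourierCoeff_one_meas 0
  rw [h, (zero_mem (lowPart 1 0)).2 0 le_rfl] at h1
  simp at h1

section Determined

variable {p : ℝ≥0∞} [Fact (1 ≤ p)] {m : ℕ}

theorem mem_toeplitzGraph_of_act_eq {Ω : Matrix (Fin m) (Fin m) (RatFunc ℂ)} {f g : HardyVec p m}
    (h : act Ω (toMeasVec f) = toMeasVec g) : (f, g) ∈ toeplitzGraph p Ω := by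
  refine mem_toeplitzGraph_iff.2 ⟨fun i => g i, 0, fun i => zero_mem _, ?_, ?_⟩
  · funext i
    rw [h, Pi.zero_apply, map_zero, add_zero]
    rfl
  · funext i
    exact (rieszProjection_coe (g i)).symm

/-- The free factor `d'` allows the columns of two symbols to be cleared by the same polynomial. -/
theorem exists_common_denominator (Ω : Matrix (Fin m) (Fin m) (RatFunc ℂ)) (j : Fin m) :
    ∃ d : ℂ[X], d ≠ 0 ∧ ∀ d' : ℂ[X], ∃ a : Fin m → ℂ[X], ∀ i,
      Ω i j * algebraMap ℂ[X] (RatFunc ℂ) (d * d') = algebraMap ℂ[X] (RatFunc ℂ) (a i) := by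
  refine ⟨∏ i, (Ω i j).denom, Finset.prod_ne_zero_iff.2 fun i _ => RatFunc.denom_ne_zero _,
    fun d' => ?_⟩
  have h : ∀ i, ∃ a : ℂ[X], Ω i j * algebraMap ℂ[X] (RatFunc ℂ) ((∏ i, (Ω i j).denom) * d') =
      algebraMap ℂ[X] (RatFunc ℂ) a := fun i => by
    obtain ⟨b, hb⟩ :=
      (Finset.dvd_prod_of_mem (fun i => (Ω i j).denom) (Finset.mem_univ i)).mul_right d'
    refine ⟨(Ω i j).num * b, ?_⟩
    have hd := RatFunc.algebraMap_ne_zero (Ω i j).denom_ne_zero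
    rw [hb, map_mul, map_mul, ← mul_assoc]
    congr 1
    nth_rewrite 1 [← RatFunc.num_div_denom (Ω i j)]
    exact div_mul_cancel₀ _ hd
  choose a ha using h
  exact ⟨a, ha⟩

/-- Test on `f = D e_j`, where `D` clears the denominators of the `j`-th columns of both symbols.
Then `Ω f` and `Ω' f` are polynomial vectors, hence the values of the two operators at `f`, and
comparing them recovers the column. -/
theorem eq_of_toeplitz_eq {Ω Ω' : Matrix (Fin m) (Fin m) (RatFunc ℂ)}
    (h : toeplitz p Ω' = toeplitz p Ω) : Ω' = Ω := by
  have hgraph : toeplitzGraph p Ω' = toeplitzGraph p Ω := by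
    rw [← Submodule.toLinearPMap_graph_eq _ (toeplitzGraph_single_valued Ω'),
      ← Submodule.toLinearPMap_graph_eq _ (toeplitzGraph_single_valued Ω)]
    exact congrArg LinearPMap.graph h
  ext i j
  obtain ⟨d, hd, hΩ⟩ := exists_common_denominator Ω j
  obtain ⟨d', hd', hΩ'⟩ := exists_common_denominator Ω' j
  obtain ⟨a, ha⟩ := hΩ d'
  obtain ⟨a', ha'⟩ := hΩ' d
  rw [mul_comm d' d] at ha'
  set D := algebraMap ℂ[X] (RatFunc ℂ) (d * d') with hD
  have hD0 : D ≠ 0 := RatFunc.algebraMap_ne_zero (mul_ne_zero hd hd')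
  obtain ⟨f, hf⟩ := exists_toMeasVec_eq (p := p) (x := Pi.single j (ratToMeas D)) fun l => by
    by_cases hl : l = j
    · subst hl
      rw [Pi.single_eq_same]
      exact polynomial_mem_highPart _
    · rw [Pi.single_eq_of_ne hl]
      exact zero_mem _
  obtain ⟨g, hg⟩ := exists_toMeasVec_eq fun i => polynomial_mem_highPart (p := p) (a i)
  obtain ⟨g', hg'⟩ := exists_toMeasVec_eq fun i => polynomial_mem_highPart (p := p) (a' i)
  have hact : ∀ (Θ : Matrix (Fin m) (Fin m) (RatFunc ℂ)) l,
      act Θ (toMeasVec f) l = ratToMeas (Θ l j * D) := fun Θ l => by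
    rw [hf, act_apply, Finset.sum_eq_single j, Pi.single_eq_same, map_mul]
    · intro b _ hb
      rw [Pi.single_eq_of_ne hb, mul_zero]
    · simp
  have h1 : (f, g) ∈ toeplitzGraph p Ω :=
    mem_toeplitzGraph_of_act_eq (funext fun l => by rw [hact, ha, hg])
  have h2 : (f, g') ∈ toeplitzGraph p Ω := hgraph ▸
    mem_toeplitzGraph_of_act_eq (funext fun l => by rw [hact, ha', hg'])
  have h3 : g' - g = 0 := toeplitzGraph_single_valued Ω _ (sub_mem h2 h1) (sub_self f)
  rw [sub_eq_zero] at h3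
  have h4 : ratToMeas (Ω' i j * D) = ratToMeas (Ω i j * D) := by
    rw [ha, ha', ← congrFun hg' i, ← congrFun hg i, h3]
  exact mul_right_cancel₀ hD0 (ratToMeas.injective h4)

end Determined

/-- Bijections between fibres of equal size are glued together. -/
theorem exists_perm_of_card_eq {m : ℕ} {a b : Fin m → ℤ}
    (h : ∀ κ, (Finset.univ.filter fun j => a j = κ).card =
      (Finset.univ.filter fun j => b j = κ).card) :
    ∃ σ : Equiv.Perm (Fin m), ∀ j, a (σ j) = b j := by
  have e : ∀ κ, {j // b j = κ} ≃ {j // a j = κ} := fun κ => by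
    refine Fintype.equivOfCardEq ?_
    rw [Fintype.card_subtype, Fintype.card_subtype, h]
  exact ⟨Equiv.ofFiberEquiv e, Equiv.ofFiberEquiv_map e⟩

end RatToeplitz

end



theorem propositionP (p : ℝ≥0∞) [Fact (1 ≤ p)] (hp_one : 1 < p) (hp_top : p < ∞) {m : ℕ}
    (Ω : Matrix (Fin m) (Fin m) (RatFunc ℂ))
    (F : RatToeplitz.WienerHopfFactorization Ω) (M : RatToeplitz.MiddleForm F)
    (hM : M.IsSpecial) (hΩ : RatToeplitz.IsFredholm (RatToeplitz.toeplitz p Ω)) :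
    -- all codimensions that occur below are finite
    (∀ n : ℤ, FiniteDimensional ℂ (RatToeplitz.HardyVec p m ⧸
      LinearMap.range (RatToeplitz.toeplitz p (RatToeplitz.shift n Ω)).toFun)) ∧
    -- the number of indices equal to a given integer
    (∀ κ : ℤ, ((Finset.univ.filter fun j => M.index j = κ).card : ℤ) =
      (RatToeplitz.codimRange (RatToeplitz.toeplitz p (RatToeplitz.shift (1 - κ) Ω)) : ℤ)
        - 2 * RatToeplitz.codimRange (RatToeplitz.toeplitz p (RatToeplitz.shift (-κ) Ω))
        + RatToeplitz.codimRange (RatToeplitz.toeplitz p (RatToeplitz.shift (-κ - 1) Ω))) ∧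
    -- the operator alone determines the indices, up to their order
    (∀ (Ω' : Matrix (Fin m) (Fin m) (RatFunc ℂ)) (F' : RatToeplitz.WienerHopfFactorization Ω')
      (M' : RatToeplitz.MiddleForm F'), M'.IsSpecial →
      RatToeplitz.toeplitz p Ω' = RatToeplitz.toeplitz p Ω →
      ∃ σ : Equiv.Perm (Fin m), ∀ j, M'.index (σ j) = M.index j) := by
  refine ⟨M.finiteDimensional_quotient_range hM, M.card_index_eq p hM, fun Ω' F' M' hM' h => ?_⟩
  -- Both factorizations now belong to one symbol, so both index counts equal the same expression in
  -- codimensions.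
  obtain rfl := RatToeplitz.eq_of_toeplitz_eq h
  refine RatToeplitz.exists_perm_of_card_eq fun κ => ?_
  exact_mod_cast (M'.card_index_eq p hM' κ).trans (M.card_index_eq p hM κ).symm
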